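/- Let $\Bbbk$ be a commutative ring and let $\Lambda'$ be the free associative $\Bbbk$-algebra on $h_1,h_2,\dots$ (with $h_0=1$). For a composition $\alpha=(a_1,\dots,a_r)$ put $h_\alpha=h_{a_1}\cdots h_{a_r}$, $|\alpha|=a_1+\dots+a_r$ and $S_\alpha=S_{a_1}\times\cdots\times S_{a_r}\subset S_{|\alpha|}$. Equip $\Lambda'$ with the bilinear form given by $$(h_\beta,h_\alpha)=\sum_{c\in S_\beta\backslash S_n/S_\alpha}(-1)^{\ell(c)}\quad\text{if }|\alpha|=|\beta|=n,\qquad (h_\beta,h_\alpha)=0\quad\text{if }|\alpha|\ne|\beta|,$$ where $\ell(c)$ is the Coxeter length of the minimal length representative of the double coset $c$. Let $\Lambda$ (the odd symmetric functions) be the quotient of $\Lambda'$ by the radical of this form, with the induced form. Write $\langle m\rangle=\tfrac12 m(m+1)$ and $\langle\lambda\rangle=\langle\lambda_1\rangle+\langle\lambda_2\rangle+\cdots$ for a partition $\lambda$. Define $e_0=1$ and, for $n\ge1$, $e_n$ inductively by $\sum_{j=0}^n(-1)^{\langle j\rangle}e_jh_{n-j}=0$; put $e_\lambda=e_{\lambda_1}e_{\lambda_2}\cdots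 e_{\lambda_r}$ for a partition $\lambda=(\lambda_1\ge\dots\ge\lambda_r)$, and let $M''_{\mu\rho}=(e_\mu,e_\rho)$. For a semistandard Young tableau $T$ (rows non-decreasing, columns strictly increasing) let $\mathrm{sign}(T)$ be the sign of the minimal length permutation that sorts into non-decreasing order the row word of $T$ (the entries read left to right in each row, the rows taken from bottom to top). Let $T_\lambda$ be the tableau of shape and content $\lambda$, and define the odd Kostka number $$K_{\lambda\mu}=\mathrm{sign}(T_\lambda)\sum_T\mathrm{sign}(T),$$ the sum over all semistandard Young tableaux $T$ of shape $\lambda$ and content $\mu$. Let $\lambda^T$ denote the transpose of $\lambda$. **Corollary ("Odd RSK Correspondence II").** For every $n\ge0$ and all partitions $\mu,\rho$ of $n$, the following holds in $\Bbbk$: $$(-1)^{\langle\mu\rangle+\langle\rho\rangle}M''_{\mu\rho}=\sum_{\lambda\vdash n}(-1)^{\langle\lambda^T\rangle+|\lambda|}K_{\lambda^T\mu}K_{\lambda^T\rho}=\sum_{\lambda\vdash n}(-1)^{\lambda_2+\lambda_4+\lambda_6+\cdots}K_{\lambda^T\mu}K_{\lambda^T\rho}.$$ -/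

import Mathlib

open scoped BigOperators

namespace OddSym

noncomputable section

/-! ### Permutations, Young subgroups, double cosets -/

/-- The Coxeter length of a permutation: the number of pairs `i < j` with `σ i > σ j`. -/
def permLength {n : ℕ} (σ : Equiv.Perm (Fin n)) : ℕ :=
  (Finset.univ.filter fun p : Fin n × Fin n => p.1 < p.2 ∧ σ p.2 < σ p.1).card

/-- Cut `0, 1, 2, …` into consecutive blocks of sizes `a₁, a₂, …`; this is the (zero-based) number
of the block that contains position `i`. -/
def blockIndex : List ℕ → ℕ → ℕ
  | [], _ => 0
  | a :: α, i => if i < a then 0 else blockIndex α (i - a) + 1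

/-- The parabolic subgroup `S_{a₁} × ⋯ × S_{aₖ}` of `S_n`, for a decomposition
`α = (a₁, …, aₖ)` of `n`: the permutations that preserve each block. -/
def youngSubgroup (n : ℕ) (α : List ℕ) : Subgroup (Equiv.Perm (Fin n)) where
  carrier := {σ | ∀ i : Fin n, blockIndex α (σ i) = blockIndex α i}
  one_mem' := fun _ => rfl
  mul_mem' := by
    intro σ τ hσ hτ i
    rw [Equiv.Perm.mul_apply, hσ, hτ]
  inv_mem' := by
    intro σ hσ i
    have h := hσ (σ⁻¹ i)
    have hi : σ (σ⁻¹ i) = i := σ.apply_symm_apply i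
    rw [hi] at h
    exact h.symm

/-- The double cosets `S_β \ S_n / S_α`. -/
abbrev Cosets (n : ℕ) (β α : List ℕ) : Type :=
  DoubleCoset.Quotient (youngSubgroup n β : Set (Equiv.Perm (Fin n)))
    (youngSubgroup n α : Set (Equiv.Perm (Fin n)))

instance (n : ℕ) (β α : List ℕ) : Finite (Cosets n β α) :=
  Finite.of_surjective (DoubleCoset.mk (youngSubgroup n β) (youngSubgroup n α))
    (Quotient.mk_surjective)

instance (n : ℕ) (β α : List ℕ) : Fintype (Cosets n β α) := Fintype.ofFinite _

/-- The length of a double coset: the length of its minimal length representative. -/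
def cosetLength {n : ℕ} {β α : List ℕ} (c : Cosets n β α) : ℕ :=
  sInf {l : ℕ | ∃ σ : Equiv.Perm (Fin n),
    DoubleCoset.mk (youngSubgroup n β) (youngSubgroup n α) σ = c ∧ permLength σ = l}

/-! ### The free algebra `Λ'` and its bilinear form -/

section Algebra

variable (k : Type*) [CommRing k]

/-- `Λ'`: the free associative algebra on `h₁, h₂, h₃, …`. -/
abbrev FreeLambda : Type _ := FreeAlgebra k ℕ+

/-- The generator `h_n` of `Λ'`, with `h_0 = 1`. -/
def h (n : ℕ) : FreeLambda k :=
  if hn : 0 < n then FreeAlgebra.ι k (⟨n, hn⟩ : ℕ+) else 1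

variable {k}

/-- The number `(h_β, h_α)`: the sum of `q ^ ℓ(c)` over all `c ∈ S_β \ S_n / S_α` if
`|β| = |α| = n`, and zero if `|β| ≠ |α|`. -/
def wordForm (q : k) (β α : List ℕ) : k :=
  if β.sum = α.sum then ∑ c : Cosets α.sum β α, q ^ cosetLength c else 0

/-- The composition `(a₁, …, aᵣ)` that indexes the word `h_{a₁} ⋯ h_{aᵣ}`. -/
def wordParts (w : FreeMonoid ℕ+) : List ℕ :=
  (FreeMonoid.toList w).map fun a => (a : ℕ)

/-- The bilinear form on `Λ'`, given on the basis of words in the `h_n` by `wordForm`. -/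
def freeForm (q : k) : LinearMap.BilinForm k (FreeLambda k) :=
  (FreeAlgebra.basisFreeMonoid k ℕ+).constr k fun v =>
    (FreeAlgebra.basisFreeMonoid k ℕ+).constr k fun w =>
      wordForm q (wordParts v) (wordParts w)

theorem permLength_inv {n : ℕ} (σ : Equiv.Perm (Fin n)) : permLength σ⁻¹ = permLength σ := by
  unfold permLength
  refine Finset.card_bij' (fun p _ => (σ⁻¹ p.2, σ⁻¹ p.1)) (fun p _ => (σ p.2, σ p.1)) ?_ ?_ ?_ ?_
  · intro p hp
    simp only [Finset.mem_filter, Finset.mem_univ, true_and] at hp ⊢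
    simpa using hp.symm
  · intro p hp
    simp only [Finset.mem_filter, Finset.mem_univ, true_and] at hp ⊢
    simpa using hp.symm
  · intro p _
    simp
  · intro p _
    simp

theorem mk_inv_eq {n : ℕ} {β α : List ℕ} {σ τ : Equiv.Perm (Fin n)}
    (hst : DoubleCoset.mk (youngSubgroup n β) (youngSubgroup n α) σ =
      DoubleCoset.mk (youngSubgroup n β) (youngSubgroup n α) τ) :
    DoubleCoset.mk (youngSubgroup n α) (youngSubgroup n β) σ⁻¹ =
      DoubleCoset.mk (youngSubgroup n α) (youngSubgroup n β) τ⁻¹ := by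
  rw [DoubleCoset.eq] at hst ⊢
  obtain ⟨a, ha, b, hb, rfl⟩ := hst
  exact ⟨b⁻¹, inv_mem hb, a⁻¹, inv_mem ha, by group⟩

theorem wordForm_symm (q : k) (β α : List ℕ) : wordForm q β α = wordForm q α β := by
  unfold wordForm
  by_cases hs : β.sum = α.sum
  swap
  · rw [if_neg hs, if_neg (Ne.symm hs)]
  rw [if_pos hs, if_pos hs.symm, hs]
  generalize α.sum = n
  have hout : ∀ (γ δ : List ℕ) (c : Cosets n γ δ),
      DoubleCoset.mk (youngSubgroup n γ) (youngSubgroup n δ) c.out = c := fun γ δ c =>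
    DoubleCoset.out_eq' _ _ c
  let f : ∀ γ δ : List ℕ, Cosets n γ δ → Cosets n δ γ := fun γ δ c =>
    DoubleCoset.mk (youngSubgroup n δ) (youngSubgroup n γ) (c.out)⁻¹
  have hf : ∀ (γ δ : List ℕ) (c : Cosets n γ δ) (σ : Equiv.Perm (Fin n)),
      DoubleCoset.mk (youngSubgroup n γ) (youngSubgroup n δ) σ = c →
      DoubleCoset.mk (youngSubgroup n δ) (youngSubgroup n γ) σ⁻¹ = f γ δ c := by
    intro γ δ c σ hσ
    exact mk_inv_eq (hσ.trans (hout γ δ c).symm)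
  have hff : ∀ (γ δ : List ℕ) (c : Cosets n γ δ), f δ γ (f γ δ c) = c := by
    intro γ δ c
    rw [← hf δ γ (f γ δ c) (c.out)⁻¹ (hf γ δ c _ (hout γ δ c)), inv_inv]
    exact hout γ δ c
  refine Fintype.sum_equiv ⟨f β α, f α β, hff β α, hff α β⟩ _ _ fun c => ?_
  congr 1
  unfold cosetLength
  congr 1
  ext l
  constructor
  · rintro ⟨σ, hσ, rfl⟩
    exact ⟨σ⁻¹, hf β α c σ hσ, permLength_inv σ⟩
  · rintro ⟨σ, hσ, rfl⟩
    exact ⟨σ⁻¹, (hf α β _ σ hσ).trans (hff β α c), permLength_inv σ⟩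

theorem freeForm_symm (q : k) (x y : FreeLambda k) : freeForm q x y = freeForm q y x := by
  have hB : freeForm q = LinearMap.flip (freeForm q) := by
    refine (FreeAlgebra.basisFreeMonoid k ℕ+).ext fun v => ?_
    refine (FreeAlgebra.basisFreeMonoid k ℕ+).ext fun w => ?_
    rw [LinearMap.flip_apply]
    simp only [freeForm, Module.Basis.constr_basis]
    exact wordForm_symm _ _ _
  exact LinearMap.congr_fun (LinearMap.congr_fun hB x) y

/-! ### The quotient `Λ` by the radical -/

/-- The radical of the bilinear form on `Λ'`. -/
def radical (q : k) : Submodule k (FreeLambda k) := LinearMap.ker (freeForm q)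

/-- `Λ^q`: the quotient of `Λ'` by the radical of its bilinear form. -/
abbrev Lambda (q : k) : Type _ := FreeLambda k ⧸ radical q

/-- The bilinear form on `Λ^q` induced by that of `Λ'`. -/
def form (q : k) : LinearMap.BilinForm k (Lambda q) :=
  (radical q).liftQ
    (LinearMap.flip ((radical q).liftQ (LinearMap.flip (freeForm q)) (by
      intro x hx
      rw [LinearMap.mem_ker]
      refine LinearMap.ext fun y => ?_
      rw [LinearMap.flip_apply, freeForm_symm, LinearMap.mem_ker.mp hx])))
    (by
      intro x hx
      rw [LinearMap.mem_ker]
      refine LinearMap.ext fun y => ?_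
      obtain ⟨y, rfl⟩ := (radical q).mkQ_surjective y
      change freeForm q x y = 0
      rw [LinearMap.mem_ker.mp hx]
      rfl)

theorem form_mk (q : k) (x y : FreeLambda k) :
    form q ((radical q).mkQ x) ((radical q).mkQ y) = freeForm q x y := rfl

/-! ### Odd elementary functions (`q = -1`) -/

/-- `⟨m⟩ = m (m + 1) / 2`. -/
def ang (m : ℕ) : ℕ := m * (m + 1) / 2

variable (k)

/-- The element `e_n`, written in the generators `h_1, h_2, …`: `e_0 = 1`, and `e_n` for `n ≥ 1` is
obtained by solving `∑_{j=0}^n (-1)^⟨j⟩ e_j h_{n-j} = 0` for its last term. -/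
def e : ℕ → FreeLambda k
  | 0 => 1
  | n + 1 => -((-1) ^ ang (n + 1) * ∑ j : Fin (n + 1), (-1) ^ ang j * (e j * h k (n + 1 - j)))
termination_by n => n
decreasing_by exact j.2

theorem e_relation (n : ℕ) (hn : 0 < n) :
    ∑ j ∈ Finset.range (n + 1), (-1) ^ ang j * (e k j * h k (n - j)) = 0 := by
  obtain ⟨m, rfl⟩ : ∃ m, n = m + 1 := ⟨n - 1, by omega⟩
  rw [Finset.sum_range_succ, Finset.sum_range]
  have h0 : h k (m + 1 - (m + 1)) = 1 := by simp [h]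
  rw [h0, mul_one, e, mul_neg, ← mul_assoc, ← pow_add, Even.neg_one_pow ⟨_, rfl⟩, one_mul]
  exact add_neg_cancel _

end Algebra

/-! ### Partitions, tableaux, odd Kostka numbers

A partition `λ = (λ₁, λ₂, …)` is a Young diagram; its row lengths are `λ_{i+1} = λ.rowLen i`. -/

theorem finite_partitions (n : ℕ) : {lam : YoungDiagram | lam.card = n}.Finite := by
  refine Set.Finite.of_finite_image (f := YoungDiagram.cells)
    (((Finset.range n ×ˢ Finset.range n).powerset).finite_toSet.subset ?_) ?_
  · rintro _ ⟨lam, hlam, rfl⟩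
    simp only [Finset.coe_powerset, Set.mem_preimage, Set.mem_powerset_iff, Finset.coe_subset]
    rintro ⟨i, j⟩ hij
    have hij' : (i, j) ∈ lam := hij
    rw [← (show lam.card = n from hlam), Finset.mem_product, Finset.mem_range, Finset.mem_range]
    constructor
    · refine lt_of_lt_of_le (YoungDiagram.mem_iff_lt_colLen.mp hij') ?_
      rw [YoungDiagram.colLen_eq_card]
      exact Finset.card_le_card (Finset.filter_subset _ _)
    · refine lt_of_lt_of_le (YoungDiagram.mem_iff_lt_rowLen.mp hij') ?_
      rw [YoungDiagram.rowLen_eq_card]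
      exact Finset.card_le_card (Finset.filter_subset _ _)
  · intro a _ b _ hab
    exact YoungDiagram.ext hab

/-- The finite set of all partitions of `n`. -/
def partitions (n : ℕ) : Finset YoungDiagram := (finite_partitions n).toFinset

/-- `T` has content `μ`. Letters are zero-based: the letter `i` of a tableau here stands for the
letter `i + 1`, so it has to occur `μ_{i+1} = μ.rowLen i` times. -/
def HasContent {lam : YoungDiagram} (T : SemistandardYoungTableau lam) (mu : YoungDiagram) : Prop :=
  ∀ i : ℕ, (lam.cells.filter fun c => T c.1 c.2 = i).card = mu.rowLen i

theorem finite_tableaux (lam mu : YoungDiagram) :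
    {T : SemistandardYoungTableau lam | HasContent T mu}.Finite := by
  let F : SemistandardYoungTableau lam → (lam.cells → ℕ) := fun T c => T c.1.1 c.1.2
  refine Set.Finite.of_finite_image (f := F)
    ((Set.finite_Iic (fun _ : lam.cells => mu.colLen 0)).subset ?_) ?_
  · rintro _ ⟨T, hT, rfl⟩ c
    have hpos : 0 < mu.rowLen (T c.1.1 c.1.2) := by
      rw [← hT]
      exact Finset.card_pos.mpr ⟨c.1, Finset.mem_filter.mpr ⟨c.2, rfl⟩⟩
    exact (YoungDiagram.mem_iff_lt_colLen.mp (YoungDiagram.mem_iff_lt_rowLen.mpr hpos)).le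
  · intro S _ T _ hST
    ext i j
    by_cases hij : (i, j) ∈ lam
    · exact congrFun hST ⟨(i, j), hij⟩
    · rw [S.zeros hij, T.zeros hij]

/-- The finite set of semistandard Young tableaux of shape `λ` and content `μ`. -/
def tableaux (lam mu : YoungDiagram) : Finset (SemistandardYoungTableau lam) :=
  (finite_tableaux lam mu).toFinset

/-- The row word of a tableau: its entries read left to right in each row, the rows taken from
bottom to top. -/
def rowWord {lam : YoungDiagram} (T : SemistandardYoungTableau lam) : List ℕ :=
  (List.range (lam.colLen 0)).reverse.flatMap fun i => (List.range (lam.rowLen i)).map fun j => T i j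

/-- The minimal length of a permutation that sorts the word `w` into non-decreasing order. -/
def sortLength (w : List ℕ) : ℕ :=
  sInf {l : ℕ | ∃ σ : Equiv.Perm (Fin w.length), Monotone (fun i => w.get (σ i)) ∧ permLength σ = l}

/-- `sign(T)`: the sign of the minimal length permutation sorting the row word of `T`. -/
def tabSign {lam : YoungDiagram} (T : SemistandardYoungTableau lam) : ℤ :=
  (-1) ^ sortLength (rowWord T)

/-- The odd Kostka number `K_{λμ} = sign(T_λ) ∑_T sign(T)`, the sum over semistandard Young tableaux
`T` of shape `λ` and content `μ`; `T_λ` is the tableau of shape and content `λ`. -/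
def kostka (lam mu : YoungDiagram) : ℤ :=
  tabSign (SemistandardYoungTableau.highestWeight lam) * ∑ T ∈ tableaux lam mu, tabSign T

/-- `⟨λ⟩ = ⟨λ₁⟩ + ⟨λ₂⟩ + ⋯`. -/
def angPart (lam : YoungDiagram) : ℕ := (lam.rowLens.map ang).sum

/-- `λ₂ + λ₄ + λ₆ + ⋯`. -/
def evenRows (lam : YoungDiagram) : ℕ :=
  ∑ i ∈ (Finset.range (lam.colLen 0)).filter Odd, lam.rowLen i

/-- The odd elementary symmetric function `e_λ = e_{λ₁} e_{λ₂} ⋯ e_{λᵣ}` in `Λ = Λ^{-1}`. -/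
def ePart (k : Type*) [CommRing k] (lam : YoungDiagram) : Lambda (-1 : k) :=
  (radical (-1 : k)).mkQ ((lam.rowLens.map (e k)).prod)

/-- `M''_{μρ} = (e_μ, e_ρ)`. -/
def Mdd (k : Type*) [CommRing k] (mu rho : YoungDiagram) : k :=
  form (-1 : k) (ePart k mu) (ePart k rho)

end

end OddSym

namespace OddSym

noncomputable section

/-! ### Young diagrams as sequences of row lengths -/

/-! The form on `Λ'` is realised on a signed Fock space, the free module on partitions. The
generator `h_n` acts by adding horizontal strips with `n` cells, each weighted by `(-1) ^ stripExp`,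
and partitions are orthogonal with `λ` of norm `(-1)^(λ₂ + λ₄ + ⋯)`. The adjoint of adding strips is
removing them, and the two families commute up to signs and lower terms (`remStrip_addStrip`). This
is a signed version of the local rule of RSK growth diagrams; its sign bookkeeping is `local_sign`.

Moving all removals to the right shows that the vectors obtained from `h_β` and `h_α` on the empty
partition pair to a signed count of nonnegative integer matrices with row sums `β` and column sums
`α` (`fockForm_stripVec`). Such matrices index the double cosets of Young subgroups, and the minimal
length in a double coset is the number of crossings of its matrix (`wordForm_eq_sum_matrices`).
Hence the form on `Λ'` is the Fock form pulled back along `x ↦ ∅ · x` (`freeForm_eq`).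

A sign-reversing involution (`sum_addStrip_eq_zero`) shows that adding vertical strips satisfies the
recursion defining `e_n`, so `e_n` acts in that way (`act_e`). Therefore the coefficient of `λ` in
`∅ · e_μ` is a signed sum over chains of vertical strips, that is, over transposes of semistandard
tableaux of shape `λᵀ` and content `μ`. The chain sign differs from the sorting sign of the tableau
by a factor depending only on `μ` and `λ` (`rowInv_add_rowInv_transpose`, `equalPairs_add_card`). In
`(e_μ, e_ρ)` the part depending on `λ` squares to one, which leaves the norm of `λ`, two Kostka
numbers and `(-1)^(⟨μ⟩ + ⟨ρ⟩)`. -/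

theorem ext_rowLen {lam mu : YoungDiagram} (H : ∀ i, lam.rowLen i = mu.rowLen i) : lam = mu := by
  refine YoungDiagram.ext (Finset.ext fun c => ?_)
  obtain ⟨i, j⟩ := c
  rw [YoungDiagram.mem_cells, YoungDiagram.mem_cells, YoungDiagram.mem_iff_lt_rowLen,
    YoungDiagram.mem_iff_lt_rowLen, H]

open scoped Classical in
/-- The Young diagram with row lengths `f 0 ≥ f 1 ≥ ⋯`; the empty diagram if `f` is not of this
kind. -/
def ofSeq (f : ℕ → ℕ) : YoungDiagram :=
  if hf : Antitone f ∧ ∃ N, f N = 0 then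
    { cells := (Finset.range hf.2.choose ×ˢ Finset.range (f 0)).filter fun c => c.2 < f c.1
      isLowerSet := by
        rintro ⟨i, j⟩ ⟨i', j'⟩ ⟨hi, hj⟩ hm
        simp only [Finset.coe_filter, Finset.mem_product, Finset.mem_range,
          Set.mem_ofPred_eq] at *
        have h1 := hf.1 hi
        have h2 := hf.1 (Nat.zero_le i')
        exact ⟨⟨by omega, by omega⟩, by omega⟩ }
  else ⊥

theorem rowLen_ofSeq {f : ℕ → ℕ} (hf : ∀ i, f (i + 1) ≤ f i) {N : ℕ} (hN : f N = 0) (i : ℕ) :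
    (ofSeq f).rowLen i = f i := by
  have hf' : Antitone f ∧ ∃ N, f N = 0 := ⟨antitone_nat_of_succ_le hf, N, hN⟩
  refine eq_of_forall_lt_iff fun j => ?_
  rw [← YoungDiagram.mem_iff_lt_rowLen, ← YoungDiagram.mem_cells, ofSeq, dif_pos hf']
  simp only [Finset.mem_filter, Finset.mem_product, Finset.mem_range]
  constructor
  · exact fun H => H.2
  · intro H
    have h2 := hf'.1 (Nat.zero_le i)
    refine ⟨⟨?_, by omega⟩, H⟩
    by_contra hc
    have h1 := hf'.1 (not_lt.mp hc)
    have h3 := hf'.2.choose_spec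
    omega

theorem rowLen_eq_zero_of_le {lam : YoungDiagram} {N i : ℕ} (hN : lam.rowLen N = 0) (hi : N ≤ i) :
    lam.rowLen i = 0 :=
  Nat.le_zero.mp (hN ▸ lam.rowLen_anti N i hi)

theorem sum_cells {M : Type*} [AddCommMonoid M] (lam : YoungDiagram) {N : ℕ}
    (hN : lam.rowLen N = 0) (f : ℕ × ℕ → M) :
    ∑ c ∈ lam.cells, f c = ∑ i ∈ Finset.range N, ∑ j ∈ Finset.range (lam.rowLen i), f (i, j) := by
  rw [Finset.sum_sigma']
  refine Finset.sum_bij' (fun c _ => ⟨c.1, c.2⟩) (fun p _ => (p.1, p.2)) ?_ ?_ ?_ ?_ ?_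
  · rintro ⟨i, j⟩ hc
    rw [YoungDiagram.mem_cells, YoungDiagram.mem_iff_lt_rowLen] at hc
    simp only [Finset.mem_sigma, Finset.mem_range]
    refine ⟨?_, hc⟩
    by_contra hi
    have := rowLen_eq_zero_of_le hN (not_lt.mp hi)
    omega
  · rintro ⟨i, j⟩ hc
    simp only [Finset.mem_sigma, Finset.mem_range] at hc
    rw [YoungDiagram.mem_cells, YoungDiagram.mem_iff_lt_rowLen]
    exact hc.2
  all_goals intros; rfl

theorem card_eq_sum_rowLen (lam : YoungDiagram) {N : ℕ} (hN : lam.rowLen N = 0) :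
    lam.card = ∑ i ∈ Finset.range N, lam.rowLen i := by
  rw [YoungDiagram.card, Finset.card_eq_sum_ones, sum_cells lam hN]
  simp

theorem rowLen_card (lam : YoungDiagram) : lam.rowLen lam.card = 0 := by
  by_contra hc
  have hsub : (Finset.range (lam.card + 1)).image (fun i => (i, 0)) ⊆ lam.cells := by
    intro c hc'
    obtain ⟨i, hi, rfl⟩ := Finset.mem_image.mp hc'
    rw [YoungDiagram.mem_cells, YoungDiagram.mem_iff_lt_rowLen]
    have := lam.rowLen_anti i lam.card (Nat.lt_succ_iff.mp (Finset.mem_range.mp hi))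
    omega
  have h1 := Finset.card_le_card hsub
  rw [Finset.card_image_of_injective _ (fun a b hab => congrArg Prod.fst hab),
    Finset.card_range] at h1
  have : lam.card = lam.cells.card := rfl
  omega

theorem mem_partitions {n : ℕ} {lam : YoungDiagram} : lam ∈ partitions n ↔ lam.card = n := by
  simp [partitions]

theorem rowLen_bot (i : ℕ) : (⊥ : YoungDiagram).rowLen i = 0 := by
  by_contra hc
  exact YoungDiagram.notMem_bot (i, 0) (YoungDiagram.mem_iff_lt_rowLen.mpr (Nat.pos_of_ne_zero hc))

theorem card_bot : (⊥ : YoungDiagram).card = 0 := rfl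

theorem eq_bot_of_card {lam : YoungDiagram} (H : lam.card = 0) : lam = ⊥ :=
  YoungDiagram.ext (Finset.card_eq_zero.mp H)

/-- Gives one truncation point for the row sums of several diagrams, so that these sums can be
compared term by term. -/
theorem exists_common_bound (s : List YoungDiagram) : ∃ N, ∀ lam ∈ s, lam.rowLen N = 0 := by
  induction s with
  | nil => exact ⟨0, by simp⟩
  | cons a s ih =>
    obtain ⟨N, hN⟩ := ih
    refine ⟨max N a.card, fun lam hlam => ?_⟩
    rcases List.mem_cons.mp hlam with rfl | hlam
    · exact rowLen_eq_zero_of_le (rowLen_card _) (le_max_right _ _)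
    · exact rowLen_eq_zero_of_le (hN lam hlam) (le_max_left _ _)

/-! ### Strips and their signs -/

/-- `λ / μ` is a horizontal strip. -/
def IsHStrip (mu lam : YoungDiagram) : Prop :=
  ∀ i, mu.rowLen i ≤ lam.rowLen i ∧ lam.rowLen (i + 1) ≤ mu.rowLen i

/-- `λ / μ` is a vertical strip. -/
def IsVStrip (mu lam : YoungDiagram) : Prop :=
  ∀ i, mu.rowLen i ≤ lam.rowLen i ∧ lam.rowLen i ≤ mu.rowLen i + 1

/-- Modulo two, the number of pairs formed by a cell of `λ / μ` and a cell of `μ` in a higher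
row. -/
def stripExp (mu lam : YoungDiagram) : ℕ :=
  ∑ i ∈ Finset.range lam.card,
    (lam.rowLen i + mu.rowLen i) * ∑ j ∈ Finset.range i, mu.rowLen j

theorem sum_range_eq_of_vanish {M : Type*} [AddCommMonoid M] {f : ℕ → M} {N N' : ℕ}
    (H : ∀ i, N ≤ i → f i = 0) (H' : ∀ i, N' ≤ i → f i = 0) :
    ∑ i ∈ Finset.range N, f i = ∑ i ∈ Finset.range N', f i := by
  have key : ∀ {a b : ℕ}, a ≤ b → (∀ i, a ≤ i → f i = 0) →
      ∑ i ∈ Finset.range a, f i = ∑ i ∈ Finset.range b, f i := fun hab ha =>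
    Finset.sum_subset (Finset.range_mono hab) fun i _ hi => ha i (by simpa using hi)
  rcases le_total N N' with hab | hab
  · exact key hab H
  · exact (key hab H').symm

theorem stripExp_eq {mu lam : YoungDiagram} (hle : ∀ i, mu.rowLen i ≤ lam.rowLen i) {N : ℕ}
    (hN : lam.rowLen N = 0) :
    stripExp mu lam = ∑ i ∈ Finset.range N,
      (lam.rowLen i + mu.rowLen i) * ∑ j ∈ Finset.range i, mu.rowLen j := by
  have : ∀ {N : ℕ}, lam.rowLen N = 0 → ∀ i, N ≤ i →
      (lam.rowLen i + mu.rowLen i) * ∑ j ∈ Finset.range i, mu.rowLen j = 0 := by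
    intro N hN i hi
    have h1 := rowLen_eq_zero_of_le hN hi
    have h2 := hle i
    have h3 : lam.rowLen i + mu.rowLen i = 0 := by omega
    rw [h3, zero_mul]
  exact sum_range_eq_of_vanish (this (rowLen_card lam)) (this hN)

theorem rowLen_colLen (lam : YoungDiagram) : lam.rowLen (lam.colLen 0) = 0 := by
  by_contra hc
  have := YoungDiagram.mem_iff_lt_rowLen.mpr (Nat.pos_of_ne_zero hc)
  rw [YoungDiagram.mem_iff_lt_colLen] at this
  exact lt_irrefl _ this

/-- Row indices are zero-based, so the rows `λ₂, λ₄, …` have odd index and the weight `i` modulo two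
selects exactly these. -/
theorem evenRows_cast {lam : YoungDiagram} {N : ℕ} (hN : lam.rowLen N = 0) :
    (evenRows lam : ZMod 2) = ∑ i ∈ Finset.range N, (i : ZMod 2) * (lam.rowLen i : ZMod 2) := by
  have hv : ∀ {N : ℕ}, lam.rowLen N = 0 → ∀ i, N ≤ i →
      (i : ZMod 2) * (lam.rowLen i : ZMod 2) = 0 := by
    intro N hN i hi
    rw [rowLen_eq_zero_of_le hN hi]
    simp
  rw [← sum_range_eq_of_vanish (hv (rowLen_colLen lam)) (hv hN), evenRows, Finset.sum_filter, Nat.cast_sum]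
  refine Finset.sum_congr rfl fun i _ => ?_
  split_ifs with hi
  · rw [ZMod.natCast_eq_one_iff_odd.mpr hi, one_mul]
  · rw [(ZMod.natCast_eq_zero_iff_even).mpr (Nat.not_odd_iff_even.mp hi)]
    simp

/-- All sign comparisons below are made on exponents in `ZMod 2`, where they become linear algebra.
-/
theorem neg_one_pow_congr {R : Type*} [Ring R] {a b : ℕ} (H : (a : ZMod 2) = b) :
    (-1 : R) ^ a = (-1) ^ b := by
  rw [ZMod.natCast_eq_natCast_iff'] at H
  rw [neg_one_pow_eq_pow_mod_two, H, ← neg_one_pow_eq_pow_mod_two]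

/-! ### The sign identity for the local rule -/

/-- The left side collects the exponents of both paths around a local square: strip exponents, row
weights `i`, and `(|μ| - |ν|)(|ρ| - |ν|)` expanded modulo two. The relation `hrefl` couples row `i +
1` of `λ` with row `i` of `ν`, so cutting off after row `N` leaves a boundary term, the right side.
It vanishes for large `N`. Maxima and minima enter only through their sums and products; the first
row of `λ`, and with it the corner entry, has weight zero. -/
theorem local_sign_aux (mu rho lam nu mx mn : ℕ → ZMod 2)
    (hadd : ∀ i, mx i + mn i = mu i + rho i) (hmul : ∀ i, mx i * mn i = mu i * rho i)
    (hrefl : ∀ i, lam (i + 1) + nu i = mx (i + 1) + mn i) (N : ℕ) :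
    (∑ i ∈ Finset.range (N + 1), (lam i * (∑ j ∈ Finset.range i, mu j +
        ∑ j ∈ Finset.range i, rho j + i) + mu i * ∑ j ∈ Finset.range i, mu j +
        rho i * ∑ j ∈ Finset.range i, rho j)) +
      (∑ i ∈ Finset.range (N + 1), ((mu i + rho i) * ∑ j ∈ Finset.range i, nu j + i * nu i)) +
      (∑ i ∈ Finset.range (N + 1), i * (mu i + rho i)) +
      (∑ i ∈ Finset.range (N + 1), mu i) * (∑ i ∈ Finset.range (N + 1), rho i) +
      (∑ i ∈ Finset.range (N + 1), mu i + ∑ i ∈ Finset.range (N + 1), rho i + 1) *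
        ∑ i ∈ Finset.range (N + 1), nu i =
    (mn N + nu N) * (∑ i ∈ Finset.range (N + 1), mu i + ∑ i ∈ Finset.range (N + 1), rho i +
      (N + 1 : ℕ)) := by
  induction N with
  | zero =>
    simp only [zero_add, Finset.sum_range_one, Finset.range_zero, Finset.sum_empty]
    have h1 := hadd 0
    have h2 := hmul 0
    push_cast
    generalize mu 0 = a at *
    generalize rho 0 = b at *
    generalize nu 0 = c at *
    generalize lam 0 = d at *
    generalize mx 0 = x at *
    generalize mn 0 = y at *
    revert a b c d x y
    decide
  | succ N ih =>
    have h1 := hadd (N + 1)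
    have h2 := hmul (N + 1)
    have h3 := hrefl N
    simp only [Finset.sum_range_succ _ (N + 1)]
    generalize (∑ i ∈ Finset.range (N + 1), mu i) = M at *
    generalize (∑ i ∈ Finset.range (N + 1), rho i) = R at *
    generalize (∑ i ∈ Finset.range (N + 1), nu i) = V at *
    generalize hE : (∑ i ∈ Finset.range (N + 1), (lam i * (∑ j ∈ Finset.range i, mu j +
        ∑ j ∈ Finset.range i, rho j + i) + mu i * ∑ j ∈ Finset.range i, mu j +
        rho i * ∑ j ∈ Finset.range i, rho j)) = E at *
    generalize (∑ i ∈ Finset.range (N + 1), ((mu i + rho i) * ∑ j ∈ Finset.range i, nu j +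
      i * nu i)) = F at *
    generalize (∑ i ∈ Finset.range (N + 1), (i : ZMod 2) * (mu i + rho i)) = S at *
    have hc : ((N + 1 + 1 : ℕ) : ZMod 2) = ((N + 1 : ℕ) : ZMod 2) + 1 := by push_cast; ring
    rw [hc]
    generalize ((N + 1 : ℕ) : ZMod 2) = t at *
    generalize mu (N + 1) = a at *
    generalize rho (N + 1) = b at *
    generalize nu (N + 1) = c at *
    generalize lam (N + 1) = d at *
    generalize mx (N + 1) = x at *
    generalize mn (N + 1) = y at *
    generalize mn N = z at *
    generalize nu N = w at *
    have two : (2 : ZMod 2) = 0 := rfl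
    -- Solving for the new row of `λ`, the new maximum and the old partial sum leaves an identity
    -- that needs only the product relation and `y² = y` modulo two.
    have hd : d = x + z + w := by
      linear_combination h3 - w * two
    have hx : x = a + b + y := by linear_combination h1 - y * two
    have hE' : E = F + S + M * R + (M + R + 1) * V + (z + w) * (M + R + t) := by
      linear_combination ih - (F + S + M * R + (M + R + 1) * V) * two
    subst hd hx hE'
    have hy : y * y = y := (by decide : ∀ y : ZMod 2, y * y = y) y
    have h2' : a * b = a * y + b * y + y := by linear_combination -h2 + hy
    linear_combination (1 : ZMod 2) * h2' + (F + S + M * R + (M + R + 1) * V + t * (a + b) + (a + b) * V + (a + b) * M +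
      (a + b) * R + (z + w) * (M + R + t)) * two

/-! ### Operators that add and remove horizontal strips -/

theorem stripExp_cast {mu lam : YoungDiagram} (hle : ∀ i, mu.rowLen i ≤ lam.rowLen i) {N : ℕ}
    (hN : lam.rowLen N = 0) :
    (stripExp mu lam : ZMod 2) = ∑ i ∈ Finset.range N,
      ((lam.rowLen i : ZMod 2) + mu.rowLen i) * ∑ j ∈ Finset.range i, (mu.rowLen j : ZMod 2) := by
  rw [stripExp_eq hle hN]
  push_cast
  rfl

/-! ### The local rule of growth diagrams -/

/-- Summing the row relations replaces each `max + min` by `μ_j + ρ_j`; the induction carries the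
one minimum not yet matched with its maximum. -/
theorem card_local {mu rho lam nu : YoungDiagram} {i : ℕ}
    (h0 : lam.rowLen 0 = max (mu.rowLen 0) (rho.rowLen 0) + i)
    (hrefl : ∀ j, lam.rowLen (j + 1) + nu.rowLen j =
      max (mu.rowLen (j + 1)) (rho.rowLen (j + 1)) + min (mu.rowLen j) (rho.rowLen j)) :
    lam.card + nu.card = i + mu.card + rho.card := by
  obtain ⟨N, hN⟩ := exists_common_bound [mu, rho, lam, nu]
  simp only [List.mem_cons, List.not_mem_nil, or_false, forall_eq_or_imp, forall_eq] at hN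
  obtain ⟨hmu, hrho, hlam, hnu⟩ := hN
  have key : ∀ N, ∑ j ∈ Finset.range (N + 1), lam.rowLen j + ∑ j ∈ Finset.range N, nu.rowLen j +
      min (mu.rowLen N) (rho.rowLen N) =
      i + ∑ j ∈ Finset.range (N + 1), mu.rowLen j + ∑ j ∈ Finset.range (N + 1), rho.rowLen j := by
    intro N
    induction N with
    | zero => simp; omega
    | succ N ih =>
      rw [Finset.sum_range_succ _ (N + 1), Finset.sum_range_succ _ (N + 1),
        Finset.sum_range_succ _ (N + 1), Finset.sum_range_succ (fun j => nu.rowLen j) N]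
      have := hrefl N
      omega
  have hk := key N
  have hs := fun (l : YoungDiagram) (hl : l.rowLen N = 0) =>
    card_eq_sum_rowLen l (rowLen_eq_zero_of_le hl (Nat.le_succ N))
  rw [← hs lam hlam, ← hs mu hmu, ← hs rho hrho, ← card_eq_sum_rowLen nu hnu] at hk
  omega

theorem local_sign {mu rho lam nu : YoungDiagram} {p r : ℕ}
    (hrefl : ∀ j, lam.rowLen (j + 1) + nu.rowLen j =
      max (mu.rowLen (j + 1)) (rho.rowLen (j + 1)) + min (mu.rowLen j) (rho.rowLen j))
    (hml : IsHStrip mu lam) (hrl : IsHStrip rho lam) (hnm : IsHStrip nu mu)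
    (hnr : IsHStrip nu rho) (hp : nu.card + p = mu.card) (hr : nu.card + r = rho.card) :
    ((stripExp mu lam + (evenRows lam + evenRows rho + stripExp rho lam) : ℕ) : ZMod 2) =
      ((p * r + (evenRows mu + evenRows nu + stripExp nu mu) + stripExp nu rho : ℕ) : ZMod 2) := by
  obtain ⟨N, hN⟩ := exists_common_bound [mu, rho, lam, nu]
  simp only [List.mem_cons, List.not_mem_nil, or_false, forall_eq_or_imp, forall_eq] at hN
  obtain ⟨hmu, hrho, hlam, hnu⟩ := hN
  have key := local_sign_aux (fun i => (mu.rowLen i : ZMod 2)) (fun i => (rho.rowLen i : ZMod 2))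
    (fun i => (lam.rowLen i : ZMod 2)) (fun i => (nu.rowLen i : ZMod 2))
    (fun i => ((max (mu.rowLen i) (rho.rowLen i) : ℕ) : ZMod 2))
    (fun i => ((min (mu.rowLen i) (rho.rowLen i) : ℕ) : ZMod 2))
    (fun i => by rw [← Nat.cast_add, ← Nat.cast_add, max_add_min])
    (fun i => by rw [← Nat.cast_mul, ← Nat.cast_mul, max_mul_min])
    (fun i => by rw [← Nat.cast_add, ← Nat.cast_add, hrefl]) N
  -- Beyond the last row of all four diagrams the boundary term of `local_sign_aux` disappears.
  have h0 : (((min (mu.rowLen N) (rho.rowLen N) : ℕ) : ZMod 2) + (nu.rowLen N : ZMod 2)) = 0 := by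
    rw [hmu, hnu]; simp
  simp only [h0, zero_mul] at key
  have hs := fun (l : YoungDiagram) (hl : l.rowLen N = 0) =>
    rowLen_eq_zero_of_le hl (Nat.le_succ N)
  have hcard : ∀ l : YoungDiagram, l.rowLen N = 0 →
      ∑ i ∈ Finset.range (N + 1), (l.rowLen i : ZMod 2) = (l.card : ZMod 2) := by
    intro l hl
    rw [card_eq_sum_rowLen l (hs l hl), Nat.cast_sum]
  have hev : ∀ l : YoungDiagram, l.rowLen N = 0 → ∑ i ∈ Finset.range (N + 1),
      (l.rowLen i : ZMod 2) * (i : ZMod 2) = (evenRows l : ZMod 2) := by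
    intro l hl
    rw [evenRows_cast (hs l hl)]
    simp only [mul_comm]
  push_cast
  rw [stripExp_cast (fun i => (hml i).1) (hs lam hlam),
    stripExp_cast (fun i => (hrl i).1) (hs lam hlam),
    stripExp_cast (fun i => (hnm i).1) (hs mu hmu), stripExp_cast (fun i => (hnr i).1) (hs rho hrho)]
  -- With `|μ| = |ν| + p` and `|ρ| = |ν| + r`, the quadratic terms reduce to `p r`, because `|ν|² =
  -- |ν|` modulo two.
  rw [hcard mu hmu, hcard rho hrho, hcard nu hnu, ← hp, ← hr] at key
  have e1 := hev lam hlam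
  have e2 := hev mu hmu
  have e3 := hev rho hrho
  have e4 := (evenRows_cast (hs nu hnu))
  simp only [mul_comm ((_ : ℕ) : ZMod 2) ((mu.rowLen _ : ZMod 2) + _)] at key
  simp only [mul_add, add_mul, Finset.sum_add_distrib, Nat.cast_add] at key ⊢
  rw [e1, e2, e3, ← e4] at key
  have two : (2 : ZMod 2) = 0 := rfl
  have sq : ∀ y : ZMod 2, y * y = y := by decide
  have hn := sq (nu.card : ZMod 2)
  linear_combination key - 3 * hn - ((p : ZMod 2) * r + (p : ZMod 2) * nu.card +
    (r : ZMod 2) * nu.card + (evenRows mu : ZMod 2) + (evenRows nu : ZMod 2) + 2 * nu.card +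
    (∑ x ∈ Finset.range N.succ, (mu.rowLen x : ZMod 2) *
      ∑ j ∈ Finset.range x, (nu.rowLen j : ZMod 2)) +
    (∑ x ∈ Finset.range N.succ, (nu.rowLen x : ZMod 2) *
      ∑ j ∈ Finset.range x, (nu.rowLen j : ZMod 2)) +
    (∑ x ∈ Finset.range N.succ, (rho.rowLen x : ZMod 2) *
      ∑ j ∈ Finset.range x, (nu.rowLen j : ZMod 2))) * two

/-- The lower corner `ν` of the local rule with upper corner `λ`. -/
def localDown (mu rho lam : YoungDiagram) : YoungDiagram :=
  ofSeq fun j => max (mu.rowLen (j + 1)) (rho.rowLen (j + 1)) + min (mu.rowLen j) (rho.rowLen j) -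
    lam.rowLen (j + 1)

/-- The upper corner `λ` of the local rule with lower corner `ν` and corner entry `i`. -/
def localUp (mu rho nu : YoungDiagram) (i : ℕ) : YoungDiagram :=
  ofSeq fun j => match j with
    | 0 => max (mu.rowLen 0) (rho.rowLen 0) + i
    | j + 1 => max (mu.rowLen (j + 1)) (rho.rowLen (j + 1)) + min (mu.rowLen j) (rho.rowLen j) -
        nu.rowLen j

/-- Both strip conditions give `λ_{j+1} ≤ min(μ_j, ρ_j)`, so the subtraction in `localDown` is never
truncated; interlacing also makes the resulting sequence decreasing and eventually zero. -/
theorem rowLen_localDown {mu rho lam : YoungDiagram} (hm : IsHStrip mu lam)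
    (hr : IsHStrip rho lam) (j : ℕ) :
    lam.rowLen (j + 1) + (localDown mu rho lam).rowLen j =
      max (mu.rowLen (j + 1)) (rho.rowLen (j + 1)) + min (mu.rowLen j) (rho.rowLen j) := by
  rw [localDown, rowLen_ofSeq (N := mu.card)]
  · have := hm j; have := hr j; have := hm (j + 1); have := hr (j + 1)
    omega
  · intro j
    have := hm j; have := hr j; have := hm (j + 1); have := hr (j + 1)
    have := hm (j + 2); have := hr (j + 2)
    simp only [add_assoc, Nat.reduceAdd] at *
    omega
  · have h1 := rowLen_card mu
    have := hm mu.card; have := hr (mu.card + 1); have := hm (mu.card + 1)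
    omega

theorem rowLen_localUp_zero {mu rho nu : YoungDiagram} (hm : IsHStrip nu mu)
    (hr : IsHStrip nu rho) (i : ℕ) :
    (localUp mu rho nu i).rowLen 0 = max (mu.rowLen 0) (rho.rowLen 0) + i ∧
    ∀ j, (localUp mu rho nu i).rowLen (j + 1) + nu.rowLen j =
      max (mu.rowLen (j + 1)) (rho.rowLen (j + 1)) + min (mu.rowLen j) (rho.rowLen j) := by
  have key : ∀ j, (localUp mu rho nu i).rowLen j = match j with
    | 0 => max (mu.rowLen 0) (rho.rowLen 0) + i
    | j + 1 => max (mu.rowLen (j + 1)) (rho.rowLen (j + 1)) + min (mu.rowLen j) (rho.rowLen j) -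
        nu.rowLen j := by
    intro j
    rw [localUp, rowLen_ofSeq (N := mu.card + rho.card + 1)]
    · intro j
      cases j with
      | zero =>
        have := hm 0; have := hr 0
        simp only
        omega
      | succ j =>
        have := hm j; have := hr j; have := hm (j + 1); have := hr (j + 1)
        simp only
        omega
    · have h1 := rowLen_eq_zero_of_le (rowLen_card mu) (Nat.le_add_right _ rho.card)
      have h2 := rowLen_eq_zero_of_le (rowLen_card rho) (Nat.le_add_left _ mu.card)
      have h3 := mu.rowLen_anti _ _ (Nat.le_succ (mu.card + rho.card))
      have h4 := rho.rowLen_anti _ _ (Nat.le_succ (mu.card + rho.card))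
      simp only [Nat.succ_eq_add_one] at *
      omega
  refine ⟨key 0, fun j => ?_⟩
  rw [key]
  have := hm j; have := hr j
  simp only
  omega

/-- The defining relations of the local rule, with `i` the corner entry. -/
structure LocalRule (mu rho lam nu : YoungDiagram) (i : ℕ) : Prop where
  zero : lam.rowLen 0 = max (mu.rowLen 0) (rho.rowLen 0) + i
  succ : ∀ j, lam.rowLen (j + 1) + nu.rowLen j =
    max (mu.rowLen (j + 1)) (rho.rowLen (j + 1)) + min (mu.rowLen j) (rho.rowLen j)

theorem LocalRule.down {mu rho lam nu : YoungDiagram} {i : ℕ} (H : LocalRule mu rho lam nu i)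
    (hm : IsHStrip mu lam) (hr : IsHStrip rho lam) : IsHStrip nu mu ∧ IsHStrip nu rho := by
  constructor <;> intro j <;>
  · have := hm j; have := hr j; have := hm (j + 1); have := hr (j + 1)
    have := H.succ j
    omega

theorem LocalRule.up {mu rho lam nu : YoungDiagram} {i : ℕ} (H : LocalRule mu rho lam nu i)
    (hm : IsHStrip nu mu) (hr : IsHStrip nu rho) : IsHStrip mu lam ∧ IsHStrip rho lam := by
  constructor <;> intro j <;>
  · have := hm j; have := hr j
    have := H.succ j
    refine ⟨?_, by omega⟩
    cases j with
    | zero => have := H.zero; omega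
    | succ j =>
      have := H.succ j
      have := hm j; have := hr j
      omega

theorem LocalRule.unique_lam {mu rho lam lam' nu : YoungDiagram} {i : ℕ}
    (H : LocalRule mu rho lam nu i) (H' : LocalRule mu rho lam' nu i) : lam = lam' := by
  refine ext_rowLen fun j => ?_
  cases j with
  | zero => rw [H.zero, H'.zero]
  | succ j => have := H.succ j; have := H'.succ j; omega

theorem LocalRule.unique_nu {mu rho lam nu nu' : YoungDiagram} {i i' : ℕ}
    (H : LocalRule mu rho lam nu i) (H' : LocalRule mu rho lam nu' i') : nu = nu' :=
  ext_rowLen fun j => by have := H.succ j; have := H'.succ j; omega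

theorem LocalRule.card {mu rho lam nu : YoungDiagram} {i : ℕ} (H : LocalRule mu rho lam nu i) :
    lam.card + nu.card = i + mu.card + rho.card :=
  card_local H.zero H.succ

theorem localDown_rule {mu rho lam : YoungDiagram} (hm : IsHStrip mu lam)
    (hr : IsHStrip rho lam) : LocalRule mu rho lam (localDown mu rho lam)
      (lam.rowLen 0 - max (mu.rowLen 0) (rho.rowLen 0)) :=
  ⟨by have := hm 0; have := hr 0; omega, rowLen_localDown hm hr⟩

theorem localUp_rule {mu rho nu : YoungDiagram} (hm : IsHStrip nu mu)
    (hr : IsHStrip nu rho) (i : ℕ) : LocalRule mu rho (localUp mu rho nu i) nu i :=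
  ⟨(rowLen_localUp_zero hm hr i).1, (rowLen_localUp_zero hm hr i).2⟩

theorem IsHStrip.card_le {mu lam : YoungDiagram} (H : IsHStrip mu lam) : mu.card ≤ lam.card := by
  obtain ⟨N, hN⟩ := exists_common_bound [mu, lam]
  simp only [List.mem_cons, List.not_mem_nil, or_false, forall_eq_or_imp, forall_eq] at hN
  rw [card_eq_sum_rowLen mu hN.1, card_eq_sum_rowLen lam hN.2]
  exact Finset.sum_le_sum fun i _ => (H i).1

/-! ### Strip operators on the Fock space and their commutation relation -/

variable (k : Type*) [CommRing k]

/-- The free module on all partitions. -/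
abbrev Fock : Type _ := YoungDiagram →₀ k

open scoped Classical in
/-- Add a strip with `b` cells (of the kind singled out by `R`) in all possible ways, with signs. -/
def addStrip (R : YoungDiagram → YoungDiagram → Prop) (b : ℕ) : Fock k →ₗ[k] Fock k :=
  Finsupp.linearCombination k fun mu =>
    ∑ lam ∈ (partitions (mu.card + b)).filter (R mu), Finsupp.single lam ((-1) ^ stripExp mu lam)

open scoped Classical in
/-- Remove a horizontal strip with `a` cells in all possible ways, with signs. -/
def remStrip (a : ℕ) : Fock k →ₗ[k] Fock k :=
  Finsupp.linearCombination k fun lam =>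
    ∑ rho ∈ (partitions (lam.card - a)).filter (fun rho => rho.card + a = lam.card ∧
      IsHStrip rho lam),
      Finsupp.single rho ((-1) ^ (evenRows lam + evenRows rho + stripExp rho lam))

variable {k}

/-- For fixed ends `μ` and `ρ`, the local rule matches the upper corners `λ` with the pairs of a
lower corner `ν` and a corner entry `i`. Counting cells gives `|μ| - |ν| = a - i` and `|ρ| - |ν| = b
- i`; `local_sign` shows that the two paths differ in sign by `(-1)^((a-i)(b-i))`. -/
theorem remStrip_addStrip (a b : ℕ) (v : Fock k) :
    remStrip k a (addStrip k IsHStrip b v) = ∑ i ∈ Finset.range (min a b + 1),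
      (-1 : k) ^ ((a - i) * (b - i)) • addStrip k IsHStrip (b - i) (remStrip k (a - i) v) := by
  classical
  induction v using Finsupp.induction_linear with
  | zero => simp
  | add v w hv hw => simp only [map_add, hv, hw, smul_add, Finset.sum_add_distrib]
  | single mu c =>
  rw [← mul_one c, ← smul_eq_mul, ← Finsupp.smul_single]
  simp only [map_smul, smul_comm _ c, ← Finset.smul_sum]
  congr 1
  have hone : ∀ (x : YoungDiagram) (c : k), Finsupp.single x c = c • Finsupp.single x (1 : k) := by
    intro x c; rw [Finsupp.smul_single, smul_eq_mul, mul_one]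
  simp only [addStrip, remStrip, Finsupp.linearCombination_single, one_smul, map_sum,
    Finset.smul_sum]
  simp only [Finsupp.smul_single, smul_eq_mul, Finset.sum_sigma']
  refine Finset.sum_bij' (fun p _ => ⟨p.1.rowLen 0 - max (mu.rowLen 0) (p.2.rowLen 0),
      localDown mu p.2 p.1, p.2⟩)
    (fun p _ => ⟨localUp mu p.2.2 p.2.1 p.1, p.2.2⟩) ?_ ?_ ?_ ?_ ?_
  · rintro ⟨lam, rho⟩ hp
    simp only [Finset.mem_sigma, Finset.mem_filter, mem_partitions, Finset.mem_range] at hp ⊢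
    obtain ⟨⟨h1, h2⟩, h3, h4, h5⟩ := hp
    have L := localDown_rule h2 h5
    have D := L.down h2 h5
    have := L.card
    have := D.1.card_le; have := D.2.card_le
    refine ⟨?_, ⟨?_, ?_, D.1⟩, ?_, D.2⟩ <;> omega
  · rintro ⟨i, nu, rho⟩ hp
    simp only [Finset.mem_sigma, Finset.mem_filter, mem_partitions, Finset.mem_range] at hp ⊢
    obtain ⟨h1, ⟨h2, h3, h4⟩, h5, h6⟩ := hp
    have L := localUp_rule h4 h6 i
    have D := L.up h4 h6
    have := L.card
    refine ⟨⟨?_, D.1⟩, ?_, ?_, D.2⟩ <;> omega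
  · rintro ⟨lam, rho⟩ hp
    simp only [Finset.mem_sigma, Finset.mem_filter, mem_partitions] at hp
    obtain ⟨⟨h1, h2⟩, h3, h4, h5⟩ := hp
    have L := localDown_rule h2 h5
    have D := L.down h2 h5
    have := (localUp_rule D.1 D.2 _).unique_lam L
    simp only [this]
  · rintro ⟨i, nu, rho⟩ hp
    simp only [Finset.mem_sigma, Finset.mem_filter, mem_partitions, Finset.mem_range] at hp
    obtain ⟨h1, ⟨h2, h3, h4⟩, h5, h6⟩ := hp
    have L := localUp_rule h4 h6 i
    have D := L.up h4 h6
    have h7 := (localDown_rule D.1 D.2).unique_nu L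
    have h8 : (localUp mu rho nu i).rowLen 0 - max (mu.rowLen 0) (rho.rowLen 0) = i := by
      have := L.zero
      omega
    simp only [h7, h8]
  · rintro ⟨lam, rho⟩ hp
    simp only [Finset.mem_sigma, Finset.mem_filter, mem_partitions] at hp
    obtain ⟨⟨h1, h2⟩, h3, h4, h5⟩ := hp
    have L := localDown_rule h2 h5
    have D := L.down h2 h5
    have := L.card
    have := D.1.card_le; have := D.2.card_le
    simp only [← pow_add]
    congr 1
    refine neg_one_pow_congr ?_
    rw [← add_assoc (_ * _)]
    refine local_sign L.succ h2 h5 D.1 D.2 ?_ ?_ <;> omega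

/-! ### Adjointness, and the pairing of strip vectors as a signed count of matrices -/

section FockForm

variable {k : Type*} [CommRing k]

variable (k) in
/-- The bilinear form for which distinct partitions are orthogonal and `λ` has norm
`(-1) ^ (λ₂ + λ₄ + ⋯)`. -/
def fockForm : LinearMap.BilinForm k (Fock k) :=
  Finsupp.linearCombination k fun lam => ((-1) ^ evenRows lam : k) • Finsupp.lapply lam

theorem fockForm_single (lam : YoungDiagram) (c : k) (w : Fock k) :
    fockForm k (Finsupp.single lam c) w = c * ((-1) ^ evenRows lam * w lam) := by
  simp [fockForm]

/-- The factor `(-1) ^ (evenRows λ + evenRows ρ)` in `remStrip` is the ratio of the norms of `λ` and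
`ρ`; it is put there to make the two operators adjoint. -/
theorem fockForm_addStrip (a : ℕ) (v w : Fock k) :
    fockForm k v (addStrip k IsHStrip a w) = fockForm k (remStrip k a v) w := by
  classical
  induction v using Finsupp.induction_linear with
  | zero => simp
  | add v v' hv hv' => simp only [map_add, LinearMap.add_apply, hv, hv']
  | single lam c =>
  induction w using Finsupp.induction_linear with
  | zero => simp
  | add w w' hw hw' => simp only [map_add, hw, hw']
  | single rho d =>
  simp only [addStrip, remStrip, Finsupp.linearCombination_single, fockForm_single, map_smul,
    map_sum, LinearMap.sum_apply, LinearMap.smul_apply,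
    Finsupp.single_apply, smul_eq_mul, Finset.sum_ite_eq', Finset.mem_filter, mem_partitions,
    mul_ite, mul_zero, Finset.sum_ite_eq]
  by_cases H : lam.card = rho.card + a ∧ IsHStrip rho lam
  · rw [if_pos H, if_pos ⟨by omega, by omega, H.2⟩]
    have hs : ((-1 : k) ^ evenRows rho) * (-1) ^ evenRows rho = 1 := by
      rw [← pow_add, Even.neg_one_pow ⟨_, rfl⟩]
    rw [pow_add, pow_add]
    linear_combination -(c * d * (-1) ^ evenRows lam * (-1) ^ stripExp rho lam) * hs
  · rw [if_neg H, if_neg (fun H' => H ⟨by omega, H'.2.2⟩)]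

theorem addStrip_bot (R : YoungDiagram → YoungDiagram → Prop) (hR : R ⊥ ⊥) (b : ℕ) (v : Fock k) :
    addStrip k R b v ⊥ = if b = 0 then v ⊥ else 0 := by
  classical
  induction v using Finsupp.induction_linear with
  | zero => simp
  | add v v' hv hv' =>
    rw [map_add, Finsupp.add_apply, hv, hv', Finsupp.add_apply]
    split_ifs <;> simp
  | single mu c =>
  simp only [addStrip, Finsupp.linearCombination_single, Finsupp.smul_apply,
    Finsupp.finsetSum_apply, Finsupp.single_apply, smul_eq_mul, Finset.sum_ite_eq',
    Finset.mem_filter, mem_partitions, card_bot]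
  by_cases hmu : mu = ⊥
  · subst hmu
    rw [card_bot, zero_add]
    have hst : stripExp ⊥ ⊥ = 0 := rfl
    by_cases hb : b = 0
    · rw [if_pos ⟨hb.symm, hR⟩, if_pos hb, if_pos rfl, hst, pow_zero, mul_one]
    · rw [if_neg (fun H => hb H.1.symm), if_neg hb, mul_zero]
  · rw [if_neg, if_neg hmu, mul_zero, ite_self]
    rintro ⟨H, -⟩
    exact hmu (eq_bot_of_card (by omega))

theorem addStrip_zero {R : YoungDiagram → YoungDiagram → Prop} (hR : ∀ mu, R mu mu)
    (hle : ∀ mu lam, R mu lam → ∀ i, mu.rowLen i ≤ lam.rowLen i) (v : Fock k) :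
    addStrip k R 0 v = v := by
  classical
  induction v using Finsupp.induction_linear with
  | zero => simp
  | add v v' hv hv' => rw [map_add, hv, hv']
  | single mu c =>
  have hf : (partitions (mu.card + 0)).filter (R mu) = {mu} := by
    ext lam
    rw [Finset.mem_filter, mem_partitions, Finset.mem_singleton]
    refine ⟨fun H => ?_, fun H => by subst H; exact ⟨rfl, hR _⟩⟩
    have hsub : mu.cells ⊆ lam.cells := by
      rintro ⟨i, j⟩ hij
      rw [YoungDiagram.mem_cells, YoungDiagram.mem_iff_lt_rowLen] at hij ⊢
      exact hij.trans_le (hle _ _ H.2 i)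
    exact (YoungDiagram.ext (Finset.eq_of_subset_of_card_le hsub H.1.le)).symm
  -- For the empty strip the exponent need not vanish, but every summand contains the factor `2
  -- μ_i`.
  have hst : Even (stripExp mu mu) := by
    refine Finset.even_sum _ fun i _ => ?_
    exact Even.mul_right ⟨_, rfl⟩ _
  rw [addStrip, Finsupp.linearCombination_single, hf, Finset.sum_singleton, hst.neg_one_pow,
    Finsupp.smul_single, smul_eq_mul, mul_one]

theorem evenRows_bot : evenRows ⊥ = 0 := by
  simp [evenRows, rowLen_bot]

theorem remStrip_bot (a : ℕ) :
    remStrip k a (Finsupp.single ⊥ 1) = if a = 0 then Finsupp.single ⊥ 1 else 0 := by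
  classical
  rw [remStrip, Finsupp.linearCombination_single, one_smul]
  split_ifs with ha
  · subst ha
    have : (partitions ((⊥ : YoungDiagram).card - 0)).filter (fun rho =>
        rho.card + 0 = (⊥ : YoungDiagram).card ∧ IsHStrip rho ⊥) = {⊥} := by
      ext rho
      rw [Finset.mem_filter, mem_partitions, Finset.mem_singleton, card_bot]
      refine ⟨fun H => eq_bot_of_card H.1, ?_⟩
      rintro rfl
      exact ⟨rfl, rfl, fun i => by simp [rowLen_bot]⟩
    rw [this, Finset.sum_singleton, add_assoc, evenRows_bot, zero_add, zero_add]
    exact congrArg _ (pow_zero _)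
  · refine Finset.sum_eq_zero fun rho hrho => ?_
    rw [Finset.mem_filter, card_bot] at hrho
    omega

/-- `h_β` applied to the empty partition, where `β 0` is applied last. -/
def stripVec (k : Type*) [CommRing k] : {r : ℕ} → (Fin r → ℕ) → Fock k
  | 0, _ => Finsupp.single ⊥ 1
  | _ + 1, β => addStrip k IsHStrip (β 0) (stripVec k (Fin.tail β))

theorem stripVec_bot {r : ℕ} (β : Fin r → ℕ) :
    stripVec k β ⊥ = if β = 0 then 1 else 0 := by
  induction r with
  | zero => rw [if_pos (Subsingleton.elim _ _)]; simp [stripVec]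
  | succ r ih =>
    rw [stripVec, addStrip_bot _ (fun i => by simp [rowLen_bot]), ih, ← ite_and]
    congr 1
    refine propext ⟨fun H => ?_, fun H => by subst H; exact ⟨rfl, rfl⟩⟩
    funext i
    refine Fin.cases H.1 (fun i => congrFun H.2 i) i

/-- The number of pairs formed by a unit of `c` and a unit of `d` at a smaller index. -/
def colExp {r : ℕ} (c d : Fin r → ℕ) : ℕ :=
  ∑ i, ∑ j, if j < i then c i * d j else 0

theorem colExp_cons {r : ℕ} (x y : ℕ) (c d : Fin r → ℕ) :
    colExp (Fin.cons x c : Fin (r + 1) → ℕ) (Fin.cons y d) = (∑ i, c i) * y + colExp c d := by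
  simp only [colExp, Fin.sum_univ_succ, Fin.cons_zero, Fin.cons_succ, Fin.not_lt_zero, if_false,
    Finset.sum_const_zero, zero_add, Fin.succ_pos, if_true, Fin.succ_lt_succ_iff,
    Finset.sum_add_distrib, Finset.sum_mul]

/-- The vectors below `β` with sum `a`. -/
def boundedTuples {r : ℕ} (β : Fin r → ℕ) (a : ℕ) : Finset (Fin r → ℕ) :=
  (Finset.Nat.antidiagonalTuple r a).filter fun c => ∀ i, c i ≤ β i

theorem mem_boundedTuples {r : ℕ} {β : Fin r → ℕ} {a : ℕ} {c : Fin r → ℕ} :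
    c ∈ boundedTuples β a ↔ ∑ i, c i = a ∧ ∀ i, c i ≤ β i := by
  rw [boundedTuples, Finset.mem_filter, Finset.Nat.mem_antidiagonalTuple]

/-- The removal operator is pushed past one `h` at a time until it meets the empty partition. The
entry `c i` is the number of cells lost at the factor `β i`; passing the first factor costs (cells
still to be removed) times (cells kept there), which is the recursion `colExp_cons`. -/
theorem remStrip_stripVec {r : ℕ} (β : Fin r → ℕ) (a : ℕ) :
    remStrip k a (stripVec k β) =
      ∑ c ∈ boundedTuples β a, (-1 : k) ^ colExp c (β - c) • stripVec k (β - c) := by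
  induction r generalizing a with
  | zero =>
    rw [stripVec, remStrip_bot]
    split_ifs with ha
    · have : boundedTuples β a = {β} := by
        ext c
        simp [mem_boundedTuples, ha, Subsingleton.elim c β]
      rw [this, Finset.sum_singleton]
      simp [stripVec, colExp]
    · refine (Finset.sum_eq_zero fun c hc => ?_).symm
      rw [mem_boundedTuples] at hc
      simp at hc
      omega
  | succ r ih =>
    rw [stripVec, remStrip_addStrip]
    simp only [ih, map_sum, map_smul, Finset.smul_sum, smul_smul, ← pow_add, Finset.sum_sigma']
    refine Finset.sum_bij' (fun p _ => (Fin.cons p.1 p.2 : Fin (r + 1) → ℕ))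
      (fun c _ => ⟨c 0, Fin.tail c⟩) ?_ ?_ ?_ ?_ ?_
    · rintro ⟨i, c⟩ hp
      simp only [Finset.mem_sigma, Finset.mem_range, mem_boundedTuples] at hp ⊢
      obtain ⟨h1, h2, h3⟩ := hp
      refine ⟨?_, fun j => ?_⟩
      · rw [Fin.sum_univ_succ]
        simp only [Fin.cons_zero, Fin.cons_succ]
        omega
      · refine Fin.cases ?_ (fun j => ?_) j
        · simp only [Fin.cons_zero]; omega
        · rw [Fin.cons_succ]; exact h3 j
    · intro c hc
      simp only [Finset.mem_sigma, Finset.mem_range, mem_boundedTuples] at hc ⊢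
      obtain ⟨h1, h2⟩ := hc
      rw [Fin.sum_univ_succ] at h1
      have := h2 0
      refine ⟨by omega, ?_, fun j => h2 j.succ⟩
      change ∑ i : Fin r, c i.succ = _
      omega
    · rintro ⟨i, c⟩ _
      simp
    · intro c _
      simp
    · rintro ⟨i, c⟩ hp
      simp only [Finset.mem_sigma, Finset.mem_range, mem_boundedTuples] at hp
      obtain ⟨h1, h2, h3⟩ := hp
      have hsub : β - (Fin.cons i c : Fin (r + 1) → ℕ) =
          Fin.cons (β 0 - i) (Fin.tail β - c) := by
        funext j
        refine Fin.cases ?_ (fun j => ?_) j <;> simp [Fin.tail]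
      simp only [hsub, colExp_cons, h2, stripVec, Fin.tail_cons, Fin.cons_zero]

/-- The number of pairs of units of the matrix `m` (given by its columns) of which one lies strictly
below and to the left of the other. -/
def crossings {r s : ℕ} (m : Fin s → Fin r → ℕ) : ℕ :=
  ∑ l, ∑ l', if l < l' then colExp (m l) (m l') else 0

/-- The matrices with row sums `β` and column sums `α`. -/
def matrices {r s : ℕ} (β : Fin r → ℕ) (α : Fin s → ℕ) : Finset (Fin s → Fin r → ℕ) :=
  (Fintype.piFinset fun l => Finset.Nat.antidiagonalTuple r (α l)).filter fun m =>
    ∀ i, ∑ l, m l i = β i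

theorem mem_matrices {r s : ℕ} {β : Fin r → ℕ} {α : Fin s → ℕ} {m : Fin s → Fin r → ℕ} :
    m ∈ matrices β α ↔ (∀ l, ∑ i, m l i = α l) ∧ ∀ i, ∑ l, m l i = β i := by
  simp [matrices, Finset.Nat.mem_antidiagonalTuple]

theorem colExp_sum {r s : ℕ} (c : Fin r → ℕ) (m : Fin s → Fin r → ℕ) :
    ∑ l, colExp c (m l) = colExp c fun i => ∑ l, m l i := by
  simp only [colExp]
  rw [Finset.sum_comm]
  refine Finset.sum_congr rfl fun i _ => ?_
  rw [Finset.sum_comm]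
  refine Finset.sum_congr rfl fun j _ => ?_
  split_ifs
  · rw [Finset.mul_sum]
  · simp

theorem crossings_cons {r s : ℕ} (c : Fin r → ℕ) (m : Fin s → Fin r → ℕ) :
    crossings (Fin.cons c m : Fin (s + 1) → Fin r → ℕ) =
      colExp c (fun i => ∑ l, m l i) + crossings m := by
  rw [← colExp_sum]
  simp only [crossings, Fin.sum_univ_succ, Fin.cons_zero, Fin.cons_succ, Fin.not_lt_zero, if_false,
    zero_add, Fin.succ_pos, if_true, Fin.succ_lt_succ_iff]

/-- Adjointness moves the factors of `α` across the form one by one. Each one splits off a column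
`c` of the matrix and leaves the row sums `β - c` for the later columns, so its sign counts the
crossings of that column with all later ones. -/
theorem fockForm_stripVec {r s : ℕ} (β : Fin r → ℕ) (α : Fin s → ℕ) :
    fockForm k (stripVec k β) (stripVec k α) = ∑ m ∈ matrices β α, (-1) ^ crossings m := by
  induction s generalizing β with
  | zero =>
    have h1 : fockForm k (stripVec k β) (Finsupp.single ⊥ 1) = stripVec k β ⊥ := by
      generalize stripVec k β = v
      induction v using Finsupp.induction_linear with
      | zero => simp
      | add v v' hv hv' => rw [map_add, LinearMap.add_apply, hv, hv', Finsupp.add_apply]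
      | single lam c =>
        classical
        rw [fockForm_single, Finsupp.single_apply, Finsupp.single_apply]
        by_cases hl : lam = ⊥
        · subst hl
          simp [evenRows_bot]
        · rw [if_neg hl, if_neg (Ne.symm hl), mul_zero, mul_zero]
    rw [stripVec, h1, stripVec_bot]
    split_ifs with hb
    · have : matrices β α = {fun l => l.elim0} := by
        ext m
        simp [mem_matrices, hb, Subsingleton.elim m (fun l => l.elim0)]
      rw [this]
      simp [crossings]
    · refine (Finset.sum_eq_zero fun m hm => ?_).symm
      rw [mem_matrices] at hm
      exact absurd (funext fun i => by simpa using (hm.2 i).symm) hb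
  | succ s ih =>
    rw [stripVec, fockForm_addStrip, remStrip_stripVec]
    simp only [map_sum, map_smul, LinearMap.sum_apply, LinearMap.smul_apply, ih, smul_eq_mul,
      Finset.mul_sum, ← pow_add, Finset.sum_sigma']
    refine Finset.sum_bij' (fun p _ => (Fin.cons p.1 p.2 : Fin (s + 1) → Fin r → ℕ))
      (fun m _ => ⟨m 0, Fin.tail m⟩) ?_ ?_ ?_ ?_ ?_
    · rintro ⟨c, m⟩ hp
      simp only [Finset.mem_sigma, mem_matrices, mem_boundedTuples] at hp ⊢
      obtain ⟨⟨h1, h2⟩, h3, h4⟩ := hp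
      refine ⟨fun l => ?_, fun i => ?_⟩
      · refine Fin.cases ?_ (fun l => ?_) l
        · simpa using h1
        · simp only [Fin.cons_succ]; exact h3 l
      · rw [Fin.sum_univ_succ]
        simp only [Fin.cons_zero, Fin.cons_succ, h4 i, Pi.sub_apply]
        have := h2 i
        omega
    · intro m hm
      simp only [Finset.mem_sigma, mem_matrices, mem_boundedTuples] at hm ⊢
      have h2 : ∀ i, m 0 i + ∑ l : Fin s, m l.succ i = β i := fun i => by
        rw [← hm.2 i, Fin.sum_univ_succ]
      refine ⟨⟨hm.1 0, fun i => ?_⟩, fun l => hm.1 l.succ, fun i => ?_⟩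
      · have := h2 i
        omega
      · have := h2 i
        change ∑ l : Fin s, m l.succ i = β i - m 0 i
        omega
    · rintro ⟨c, m⟩ _
      simp
    · intro m _
      simp
    · rintro ⟨c, m⟩ hp
      simp only [Finset.mem_sigma, mem_matrices, mem_boundedTuples] at hp
      obtain ⟨⟨h1, h2⟩, h3, h4⟩ := hp
      rw [crossings_cons]
      congr 2
      congr 1
      funext i
      exact (h4 i).symm

end FockForm

/-! ### Double cosets of Young subgroups and matrices -/

section CosetMatrix

variable {n r s : ℕ} (f : Fin n → Fin s) (g : Fin n → Fin r)

/-- The matrix of a permutation, for the partitions of its domain and codomain into the fibres of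
`f` and `g`. -/
def permMatrix (σ : Equiv.Perm (Fin n)) (l : Fin s) (i : Fin r) : ℕ :=
  (Finset.univ.filter fun x => f x = l ∧ g (σ x) = i).card

theorem permMatrix_mul (σ a b : Equiv.Perm (Fin n)) (ha : ∀ x, g (a x) = g x)
    (hb : ∀ x, f (b x) = f x) : permMatrix f g (a * σ * b) = permMatrix f g σ := by
  funext l i
  refine Finset.card_bij' (fun x _ => b x) (fun x _ => b⁻¹ x) ?_ ?_ ?_ ?_
  · intro x hx
    simp only [Finset.mem_filter, Finset.mem_univ, true_and, Equiv.Perm.mul_apply, ha] at hx ⊢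
    exact ⟨(hb x).trans hx.1, hx.2⟩
  · intro x hx
    simp only [Finset.mem_filter, Finset.mem_univ, true_and, Equiv.Perm.mul_apply, ha] at hx ⊢
    have hx' : b (b⁻¹ x) = x := b.apply_symm_apply x
    rw [← hb (b⁻¹ x), hx']
    exact hx
  · intro x _
    simp
  · intro x _
    simp

/-- Equal matrices mean that the fibres of `(f, g ∘ τ)` and `(f, g ∘ σ)` have equal sizes. Matching
these fibres gives `b`, and then `a = τ b⁻¹ σ⁻¹` is forced. -/
theorem exists_mul_of_permMatrix_eq {σ τ : Equiv.Perm (Fin n)}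
    (H : permMatrix f g σ = permMatrix f g τ) :
    ∃ a b : Equiv.Perm (Fin n), (∀ x, g (a x) = g x) ∧ (∀ x, f (b x) = f x) ∧ τ = a * σ * b := by
  have hcard : ∀ c : Fin s × Fin r, Nonempty ({x // (f x, g (τ x)) = c} ≃
      {x // (f x, g (σ x)) = c}) := by
    rintro ⟨l, i⟩
    refine ⟨Fintype.equivOfCardEq ?_⟩
    rw [Fintype.card_subtype, Fintype.card_subtype]
    simp only [Prod.mk.injEq]
    exact (congrFun (congrFun H l) i).symm
  let b : Equiv.Perm (Fin n) := Equiv.ofFiberEquiv fun c => (hcard c).some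
  have hb : ∀ x, (f (b x), g (σ (b x))) = (f x, g (τ x)) :=
    Equiv.ofFiberEquiv_map (g := fun x => (f x, g (σ x))) fun c => (hcard c).some
  refine ⟨τ * b⁻¹ * σ⁻¹, b, fun x => ?_, fun x => congrArg Prod.fst (hb x), by group⟩
  have h1 := congrArg Prod.snd (hb (b⁻¹ (σ⁻¹ x)))
  have h2 : b (b⁻¹ (σ⁻¹ x)) = σ⁻¹ x := b.apply_symm_apply _
  have h3 : σ (σ⁻¹ x) = x := σ.apply_symm_apply x
  simp only [h2, h3] at h1
  exact h1.symm

theorem permMatrix_mem {α : Fin s → ℕ} {β : Fin r → ℕ}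
    (hf : ∀ l, (Finset.univ.filter fun x => f x = l).card = α l)
    (hg : ∀ i, (Finset.univ.filter fun x => g x = i).card = β i) (σ : Equiv.Perm (Fin n)) :
    permMatrix f g σ ∈ matrices β α := by
  rw [mem_matrices]
  constructor
  · intro l
    rw [← hf l, Finset.card_eq_sum_card_fiberwise (f := fun x => g (σ x)) (t := Finset.univ)
      (fun _ _ => Finset.mem_coe.mpr (Finset.mem_univ _))]
    simp only [permMatrix, Finset.filter_filter]
  · intro i
    have : (Finset.univ.filter fun x => g x = i).card =
        (Finset.univ.filter fun x => g (σ x) = i).card :=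
      Finset.card_bij' (fun x _ => σ⁻¹ x) (fun x _ => σ x) (by simp) (by simp) (by simp) (by simp)
    rw [← hg i, this, Finset.card_eq_sum_card_fiberwise (f := f) (t := Finset.univ)
      (fun _ _ => Finset.mem_coe.mpr (Finset.mem_univ _))]
    simp only [permMatrix, Finset.filter_filter, and_comm]

/-- The units of the matrix form a set `X` with `n` elements. One bijection to `Fin n` carries
columns to fibres of `f`, another carries rows to fibres of `g`; the permutation leads from the
first to the second. -/
theorem exists_permMatrix_eq {α : Fin s → ℕ} {β : Fin r → ℕ}
    (hf : ∀ l, (Finset.univ.filter fun x => f x = l).card = α l)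
    (hg : ∀ i, (Finset.univ.filter fun x => g x = i).card = β i)
    {m : Fin s → Fin r → ℕ} (hm : m ∈ matrices β α) : ∃ σ, permMatrix f g σ = m := by
  rw [mem_matrices] at hm
  let X := Σ p : Fin s × Fin r, Fin (m p.1 p.2)
  have h1 : ∀ l, Nonempty ({x : X // x.1.1 = l} ≃ {x // f x = l}) := by
    intro l
    refine ⟨Fintype.equivOfCardEq ?_⟩
    rw [Fintype.card_subtype, Fintype.card_subtype, hf, ← hm.1 l, Finset.card_filter,
      Fintype.sum_sigma, Fintype.sum_prod_type, Finset.sum_eq_single l]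
    · simp
    · intro l' _ hl'
      simp [hl']
    · simp
  have h2 : ∀ i, Nonempty ({x : X // x.1.2 = i} ≃ {x // g x = i}) := by
    intro i
    refine ⟨Fintype.equivOfCardEq ?_⟩
    rw [Fintype.card_subtype, Fintype.card_subtype, hg, ← hm.2 i, Finset.card_filter,
      Fintype.sum_sigma, Fintype.sum_prod_type]
    refine Finset.sum_congr rfl fun l _ => ?_
    rw [Finset.sum_eq_single i]
    · simp
    · intro l' _ hl'
      simp [hl']
    · simp
  let e1 : X ≃ Fin n := Equiv.ofFiberEquiv fun c => (h1 c).some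
  let e2 : X ≃ Fin n := Equiv.ofFiberEquiv fun c => (h2 c).some
  have he1 : ∀ x : X, f (e1 x) = x.1.1 :=
    Equiv.ofFiberEquiv_map (f := fun x : X => x.1.1) fun c => (h1 c).some
  have he2 : ∀ x : X, g (e2 x) = x.1.2 :=
    Equiv.ofFiberEquiv_map (f := fun x : X => x.1.2) fun c => (h2 c).some
  refine ⟨e1.symm.trans e2, ?_⟩
  funext l i
  have h3 : permMatrix f g (e1.symm.trans e2) l i =
      (Finset.univ.filter fun x : X => x.1 = (l, i)).card := by
    refine Finset.card_bij' (fun x _ => e1.symm x) (fun x _ => e1 x) ?_ ?_ (by simp) (by simp)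
    · intro x hx
      simp only [Finset.mem_filter, Finset.mem_univ, true_and, Equiv.trans_apply, he2] at hx ⊢
      rw [← hx.1, ← hx.2, Prod.ext_iff, ← he1, Equiv.apply_symm_apply]
      exact ⟨rfl, rfl⟩
    · intro x hx
      simp only [Finset.mem_filter, Finset.mem_univ, true_and, Equiv.trans_apply, he2, he1,
        Equiv.symm_apply_apply] at hx ⊢
      rw [hx]
      exact ⟨rfl, rfl⟩
  rw [h3, Finset.card_filter, Fintype.sum_sigma, Finset.sum_eq_single (l, i)]
  · simp
  · intro p _ hp
    simp [hp]
  · simp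

theorem crossings_permMatrix (σ : Equiv.Perm (Fin n)) :
    crossings (permMatrix f g σ) = (Finset.univ.filter fun p : Fin n × Fin n =>
      f p.1 < f p.2 ∧ g (σ p.2) < g (σ p.1)).card := by
  rw [Finset.card_eq_sum_card_fiberwise
    (f := fun p : Fin n × Fin n => ((f p.1, f p.2), (g (σ p.1), g (σ p.2)))) (t := Finset.univ)
    (fun _ _ => Finset.mem_coe.mpr (Finset.mem_univ _))]
  simp only [Fintype.sum_prod_type, crossings, colExp]
  refine Finset.sum_congr rfl fun l _ => Finset.sum_congr rfl fun l' _ => ?_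
  split_ifs with hl
  · refine Finset.sum_congr rfl fun i _ => Finset.sum_congr rfl fun j _ => ?_
    rw [Finset.filter_filter]
    split_ifs with hij
    · rw [permMatrix, permMatrix, ← Finset.card_product]
      congr 1
      ext p
      simp only [Finset.mem_product, Finset.mem_filter, Finset.mem_univ, true_and, Prod.mk.injEq]
      constructor
      · rintro ⟨⟨rfl, rfl⟩, rfl, rfl⟩
        exact ⟨⟨hl, hij⟩, ⟨rfl, rfl⟩, rfl, rfl⟩
      · rintro ⟨-, ⟨rfl, rfl⟩, rfl, rfl⟩
        exact ⟨⟨rfl, rfl⟩, rfl, rfl⟩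
    · symm
      rw [Finset.card_eq_zero, Finset.filter_eq_empty_iff]
      rintro p - ⟨⟨h1, h2⟩, h3⟩
      simp only [Prod.mk.injEq] at h3
      exact hij (by rw [← h3.2.1, ← h3.2.2]; exact h2)
  · symm
    refine Finset.sum_eq_zero fun i _ => Finset.sum_eq_zero fun j _ => ?_
    rw [Finset.filter_filter, Finset.card_eq_zero, Finset.filter_eq_empty_iff]
    rintro p - ⟨⟨h1, h2⟩, h3⟩
    simp only [Prod.mk.injEq] at h3
    exact hl (by rw [← h3.1.1, ← h3.1.2]; exact h1)

variable {f g}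

theorem crossings_le_permLength (hf : Monotone f) (σ : Equiv.Perm (Fin n)) (hg : Monotone g) :
    crossings (permMatrix f g σ) ≤ permLength σ := by
  rw [crossings_permMatrix]
  refine Finset.card_le_card fun p hp => ?_
  simp only [Finset.mem_filter, Finset.mem_univ, true_and] at hp ⊢
  exact ⟨hf.reflect_lt hp.1, hg.reflect_lt hp.2⟩

/-- The rearrangement inequality: undoing the inversion gains `(y - x)(σ x - σ y)`. -/
theorem sum_mul_lt_sum_mul_swap {σ : Equiv.Perm (Fin n)} {x y : Fin n} (hxy : x < y)
    (hs : σ y < σ x) :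
    ∑ z : Fin n, (z : ℕ) * (σ z : ℕ) < ∑ z : Fin n, (z : ℕ) * ((σ * Equiv.swap x y) z : ℕ) := by
  have hy : y ∈ Finset.univ.erase x := Finset.mem_erase.mpr ⟨hxy.ne', Finset.mem_univ _⟩
  rw [← Finset.add_sum_erase _ _ (Finset.mem_univ x), ← Finset.add_sum_erase _ _ hy,
    ← Finset.add_sum_erase _ _ (Finset.mem_univ x), ← Finset.add_sum_erase _ _ hy]
  have hrest : ∑ z ∈ (Finset.univ.erase x).erase y, (z : ℕ) * ((σ * Equiv.swap x y) z : ℕ) =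
      ∑ z ∈ (Finset.univ.erase x).erase y, (z : ℕ) * (σ z : ℕ) := by
    refine Finset.sum_congr rfl fun z hz => ?_
    simp only [Finset.mem_erase] at hz
    rw [Equiv.Perm.mul_apply, Equiv.swap_apply_of_ne_of_ne hz.2.1 hz.1]
  rw [hrest]
  simp only [Equiv.Perm.mul_apply, Equiv.swap_apply_left, Equiv.swap_apply_right]
  have h1 : (x : ℕ) < y := hxy
  have h2 : (σ y : ℕ) < σ x := hs
  nlinarith [Nat.mul_lt_mul_of_lt_of_le h1 le_rfl (Nat.succ_pos 0), mul_pos (Nat.sub_pos_of_lt h1)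
    (Nat.sub_pos_of_lt h2), Nat.sub_add_cancel h1.le, Nat.sub_add_cancel h2.le]

theorem apply_swap_of_apply_eq {ι κ : Type*} [DecidableEq ι] {f : ι → κ} {x y : ι}
    (H : f x = f y) (z : ι) : f (Equiv.swap x y z) = f z := by
  rw [Equiv.swap_apply_def]
  split_ifs with h1 h2
  · rw [h1, H]
  · rw [h2, H]
  · rfl

/-- Among the permutations with the given matrix, take one maximising `∑ z τ(z)`. An inversion
inside a block of `f` or of `g` could be swapped away without changing the matrix, increasing the
sum. So every inversion joins different blocks on both sides and is a crossing. -/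
theorem exists_permLength_eq (hf : Monotone f) (hg : Monotone g) (σ : Equiv.Perm (Fin n)) :
    ∃ τ, permMatrix f g τ = permMatrix f g σ ∧ permLength τ = crossings (permMatrix f g σ) := by
  classical
  obtain ⟨τ, hτ, hmax⟩ := Finset.exists_max_image
    (Finset.univ.filter fun τ => permMatrix f g τ = permMatrix f g σ)
    (fun τ => ∑ z : Fin n, (z : ℕ) * (τ z : ℕ)) ⟨σ, by simp⟩
  simp only [Finset.mem_filter, Finset.mem_univ, true_and] at hτ hmax
  refine ⟨τ, hτ, le_antisymm ?_ (hτ ▸ crossings_le_permLength hf τ hg)⟩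
  rw [← hτ, crossings_permMatrix]
  refine Finset.card_le_card fun p hp => ?_
  obtain ⟨x, y⟩ := p
  simp only [Finset.mem_filter, Finset.mem_univ, true_and] at hp ⊢
  have hlt := sum_mul_lt_sum_mul_swap hp.1 hp.2
  constructor
  · refine lt_of_le_of_ne (hf hp.1.le) fun heq => ?_
    have := permMatrix_mul f g τ 1 (Equiv.swap x y) (fun _ => rfl) 
      (apply_swap_of_apply_eq heq)
    rw [one_mul] at this
    exact absurd (hmax _ (this.trans hτ)) (not_le.mpr hlt)
  · refine lt_of_le_of_ne (hg hp.2.le) fun heq => ?_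
    have := permMatrix_mul f g τ (Equiv.swap (τ x) (τ y)) 1 
      (apply_swap_of_apply_eq heq.symm) (fun _ => rfl)
    rw [mul_one, ← Equiv.mul_swap_eq_swap_mul] at this
    exact absurd (hmax _ (this.trans hτ)) (not_le.mpr hlt)

end CosetMatrix

/-! ### The form on words as a signed count of matrices -/

theorem blockIndex_lt {α : List ℕ} {i : ℕ} (hi : i < α.sum) : blockIndex α i < α.length := by
  induction α generalizing i with
  | nil => simp at hi
  | cons a α ih =>
    rw [blockIndex, List.length_cons]
    split_ifs with h1
    · omega
    · rw [List.sum_cons] at hi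
      have := ih (i := i - a) (by omega)
      omega

theorem blockIndex_mono (α : List ℕ) : Monotone (blockIndex α) := by
  induction α with
  | nil => exact fun _ _ _ => le_rfl
  | cons a α ih =>
    intro i j hij
    rw [blockIndex, blockIndex]
    split_ifs with h1 h2 h2
    · exact le_rfl
    · omega
    · omega
    · have := ih (show i - a ≤ j - a by omega)
      omega

theorem card_blockIndex_eq (α : List ℕ) (l : Fin α.length) :
    ((Finset.range α.sum).filter fun i => blockIndex α i = l).card = α.get l := by
  induction α with
  | nil => exact l.elim0
  | cons a α ih =>
    rw [Finset.card_filter, List.sum_cons, Finset.sum_range_add]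
    have h1 : ∀ i ∈ Finset.range a, (if blockIndex (a :: α) i = (l : ℕ) then 1 else 0) =
        if (l : ℕ) = 0 then 1 else 0 := by
      intro i hi
      rw [blockIndex, if_pos (Finset.mem_range.mp hi)]
      simp only [eq_comm]
    have h2 : ∀ i, blockIndex (a :: α) (a + i) = blockIndex α i + 1 := by
      intro i
      rw [blockIndex, if_neg (by omega), Nat.add_sub_cancel_left]
    rw [Finset.sum_congr rfl h1]
    simp only [h2]
    refine Fin.cases ?_ (fun l => ?_) l
    · simp
    · have := ih l
      rw [Finset.card_filter] at this
      simpa using this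

theorem card_fin_filter {n : ℕ} (p : ℕ → Prop) [DecidablePred p] :
    (Finset.univ.filter fun x : Fin n => p x).card = ((Finset.range n).filter p).card := by
  rw [Finset.card_filter, Finset.card_filter, Finset.sum_range]

/-- The matrix is a complete invariant of the double coset, every matrix with the right margins
occurs, and the number of crossings is a lower bound for the length that is attained. -/
theorem wordForm_eq_sum_matrices {k : Type*} [CommRing k] (q : k) {β α : List ℕ}
    (hs : β.sum = α.sum) :
    wordForm q β α = ∑ m ∈ matrices β.get α.get, q ^ crossings m := by
  let n := α.sum
  let f : Fin n → Fin α.length := fun x => ⟨blockIndex α x, blockIndex_lt x.2⟩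
  let g : Fin n → Fin β.length := fun x => ⟨blockIndex β x, blockIndex_lt (hs ▸ x.2)⟩
  have hf : Monotone f := fun x y hxy => blockIndex_mono α hxy
  have hg : Monotone g := fun x y hxy => blockIndex_mono β hxy
  have hfc : ∀ l, (Finset.univ.filter fun x => f x = l).card = α.get l := by
    intro l
    rw [← card_blockIndex_eq, ← card_fin_filter]
    simp only [f, Fin.ext_iff, n]
  have hgc : ∀ i, (Finset.univ.filter fun x => g x = i).card = β.get i := by
    intro l
    rw [← card_blockIndex_eq, hs, ← card_fin_filter]
    simp only [g, Fin.ext_iff, n]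
  have hmf : ∀ σ : Equiv.Perm (Fin n), σ ∈ youngSubgroup n α ↔ ∀ x, f (σ x) = f x := by
    intro σ
    simp only [f, Fin.ext_iff]
    rfl
  have hmg : ∀ σ : Equiv.Perm (Fin n), σ ∈ youngSubgroup n β ↔ ∀ x, g (σ x) = g x := by
    intro σ
    simp only [g, Fin.ext_iff]
    rfl
  have hmk : ∀ σ τ : Equiv.Perm (Fin n),
      DoubleCoset.mk (youngSubgroup n β) (youngSubgroup n α) σ =
        DoubleCoset.mk (youngSubgroup n β) (youngSubgroup n α) τ ↔
      permMatrix f g σ = permMatrix f g τ := by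
    intro σ τ
    rw [DoubleCoset.eq]
    constructor
    · rintro ⟨a, ha, b, hb, rfl⟩
      exact (permMatrix_mul f g σ a b ((hmg a).mp ha) ((hmf b).mp hb)).symm
    · intro H
      obtain ⟨a, b, ha, hb, hab⟩ := exists_mul_of_permMatrix_eq f g H
      exact ⟨a, (hmg a).mpr ha, b, (hmf b).mpr hb, hab⟩
  have hout : ∀ c : Cosets n β α,
      DoubleCoset.mk (youngSubgroup n β) (youngSubgroup n α) c.out = c := fun c =>
    DoubleCoset.out_eq' _ _ c
  rw [wordForm, if_pos hs]
  refine Finset.sum_bij (fun (c : Cosets n β α) _ => permMatrix f g c.out) ?_ ?_ ?_ ?_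
  · exact fun c _ => permMatrix_mem f g hfc hgc _
  · intro c _ c' _ H
    rw [← hout c, ← hout c', hmk]
    exact H
  · intro m hm
    obtain ⟨σ, rfl⟩ := exists_permMatrix_eq f g hfc hgc hm
    exact ⟨DoubleCoset.mk _ _ σ, Finset.mem_univ _, (hmk _ _).mp (hout _)⟩
  · intro c _
    congr 1
    refine le_antisymm ?_ ?_
    · obtain ⟨τ, h1, h2⟩ := exists_permLength_eq hf hg c.out
      exact Nat.sInf_le ⟨τ, ((hmk _ _).mpr h1).trans (hout c), h2⟩
    · refine le_csInf ⟨_, c.out, hout c, rfl⟩ ?_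
      rintro l ⟨σ, h1, rfl⟩
      have h2 := (hmk σ c.out).mp (h1.trans (hout c).symm)
      exact h2 ▸ crossings_le_permLength hf σ hg

/-- Reversing both orders exchanges the two units of a crossing. This reconciles the conventions: a
word acts with its first letter first, whereas `stripVec` applies index `0` last. -/
theorem crossings_rev {r s : ℕ} (m : Fin s → Fin r → ℕ) :
    crossings (fun l i => m l.rev i.rev) = crossings m := by
  have hcol : ∀ c d : Fin r → ℕ, colExp (fun i => c i.rev) (fun i => d i.rev) = colExp d c := by
    intro c d
    rw [colExp, colExp, Finset.sum_comm, ← Equiv.sum_comp Fin.revPerm]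
    refine Finset.sum_congr rfl fun i _ => ?_
    rw [← Equiv.sum_comp Fin.revPerm]
    simp only [Fin.revPerm_apply, Fin.rev_rev, Fin.rev_lt_rev, mul_comm]
  simp only [crossings, hcol]
  rw [Finset.sum_comm, ← Equiv.sum_comp Fin.revPerm]
  refine Finset.sum_congr rfl fun i _ => ?_
  rw [← Equiv.sum_comp Fin.revPerm]
  simp only [Fin.revPerm_apply, Fin.rev_rev, Fin.rev_lt_rev]

theorem sum_matrices_rev {M : Type*} [AddCommMonoid M] {r s : ℕ} (β : Fin r → ℕ) (α : Fin s → ℕ)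
    (F : ℕ → M) : ∑ m ∈ matrices (fun i => β i.rev) (fun l => α l.rev), F (crossings m) =
      ∑ m ∈ matrices β α, F (crossings m) := by
  refine Finset.sum_bij' (fun m _ l i => m l.rev i.rev) (fun m _ l i => m l.rev i.rev)
    ?_ ?_ ?_ ?_ ?_
  · intro m hm
    rw [mem_matrices] at hm ⊢
    refine ⟨fun l => ?_, fun i => ?_⟩
    · rw [← Equiv.sum_comp Fin.revPerm]
      simpa using hm.1 l.rev
    · rw [← Equiv.sum_comp Fin.revPerm]
      simpa using hm.2 i.rev
  · intro m hm
    rw [mem_matrices] at hm ⊢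
    refine ⟨fun l => ?_, fun i => ?_⟩
    · rw [← Equiv.sum_comp Fin.revPerm]
      simpa using hm.1 l.rev
    · rw [← Equiv.sum_comp Fin.revPerm]
      simpa using hm.2 i.rev
  · intro m _
    simp
  · intro m _
    simp
  · intro m _
    rw [crossings_rev]

/-- `h_β` applied to the empty partition, where the head of `β` is applied first. -/
def wordVec (k : Type*) [CommRing k] (β : List ℕ) : Fock k :=
  β.foldl (fun v b => addStrip k IsHStrip b v) (Finsupp.single ⊥ 1)

theorem wordVec_eq_stripVec {k : Type*} [CommRing k] (β : List ℕ) :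
    wordVec k β = stripVec k fun i => β.get i.rev := by
  have key : ∀ {r : ℕ} (b : Fin r → ℕ),
      wordVec k (List.ofFn b) = stripVec k fun i => b i.rev := by
    intro r
    induction r with
    | zero => intro b; simp [wordVec, stripVec]
    | succ r ih =>
      intro b
      rw [List.ofFn_succ', List.concat_eq_append, wordVec, List.foldl_append]
      have := ih fun i => b i.castSucc
      rw [wordVec] at this
      rw [this]
      simp only [List.foldl_cons, List.foldl_nil, stripVec, Fin.rev_zero]
      congr 2
      funext i
      simp [Fin.tail, Fin.rev_succ]
  conv_lhs => rw [← List.ofFn_get β]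
  exact key _

theorem fockForm_wordVec {k : Type*} [CommRing k] (β α : List ℕ) :
    fockForm k (wordVec k β) (wordVec k α) = wordForm (-1) β α := by
  rw [wordVec_eq_stripVec, wordVec_eq_stripVec, fockForm_stripVec,
    sum_matrices_rev β.get α.get fun x => (-1 : k) ^ x]
  by_cases hs : β.sum = α.sum
  · rw [wordForm_eq_sum_matrices _ hs]
  · rw [wordForm, if_neg hs]
    -- There is no such matrix: its total would be both `|β|` and `|α|`.
    refine Finset.sum_eq_zero fun m hm => absurd ?_ hs
    rw [mem_matrices] at hm
    have hsum : ∀ γ : List ℕ, γ.sum = ∑ i, γ.get i := fun γ => by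
      rw [← List.sum_ofFn, List.ofFn_get]
    rw [hsum, hsum, ← Finset.sum_congr rfl fun i _ => hm.2 i,
      ← Finset.sum_congr rfl fun i _ => hm.1 i, Finset.sum_comm]

theorem IsVStrip.refl (mu : YoungDiagram) : IsVStrip mu mu := fun _ => ⟨le_rfl, Nat.le_succ _⟩

theorem IsHStrip.refl (mu : YoungDiagram) : IsHStrip mu mu := fun i =>
  ⟨le_rfl, mu.rowLen_anti _ _ (Nat.le_succ i)⟩

theorem IsVStrip.card_le {mu lam : YoungDiagram} (H : IsVStrip mu lam) : mu.card ≤ lam.card := by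
  obtain ⟨N, hN⟩ := exists_common_bound [mu, lam]
  simp only [List.mem_cons, List.not_mem_nil, or_false, forall_eq_or_imp, forall_eq] at hN
  rw [card_eq_sum_rowLen mu hN.1, card_eq_sum_rowLen lam hN.2]
  exact Finset.sum_le_sum fun i _ => (H i).1

/-! ### Toggling a cell in the last row of a skew shape -/

/-- The last row in which `λ` is longer than `μ`. -/
def lastRow (mu lam : YoungDiagram) : ℕ :=
  Nat.findGreatest (fun i => mu.rowLen i < lam.rowLen i) lam.card

theorem lastRow_spec {mu lam : YoungDiagram} (hle : ∀ i, mu.rowLen i ≤ lam.rowLen i)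
    (hlt : mu.card < lam.card) : mu.rowLen (lastRow mu lam) < lam.rowLen (lastRow mu lam) ∧
      ∀ i, lastRow mu lam < i → lam.rowLen i = mu.rowLen i := by
  have hex : ∃ i ≤ lam.card, mu.rowLen i < lam.rowLen i := by
    by_contra hc
    push Not at hc
    have h0 : mu.rowLen lam.card = 0 := by
      have := hle lam.card
      have := rowLen_card lam
      omega
    refine absurd hlt (not_lt.mpr ?_)
    rw [card_eq_sum_rowLen mu h0]
    conv_lhs => rw [card_eq_sum_rowLen lam (rowLen_card lam)]
    exact Finset.sum_le_sum fun i hi => hc i (Finset.mem_range.mp hi).le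
  obtain ⟨i, hi, hlt'⟩ := hex
  refine ⟨Nat.findGreatest_spec (P := fun i => mu.rowLen i < lam.rowLen i) hi hlt', fun j hj => ?_⟩
  rcases le_or_gt j lam.card with hj' | hj'
  · have := Nat.findGreatest_is_greatest hj hj'
    have := hle j
    omega
  · have := rowLen_eq_zero_of_le (rowLen_card lam) hj'.le
    have := hle j
    omega

/-- Add to `κ` a cell in row `p`, or remove it, so that the row has length `μ_p` or `μ_p + 1`. -/
def toggle (mu kap : YoungDiagram) (p : ℕ) : YoungDiagram :=
  ofSeq fun i => if i = p then 2 * mu.rowLen p + 1 - kap.rowLen p else kap.rowLen i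

theorem rowLen_toggle {mu lam kap : YoungDiagram} (hv : IsVStrip mu kap) (hh : IsHStrip kap lam)
    {p : ℕ} (hp : mu.rowLen p < lam.rowLen p) (hp' : ∀ i, p < i → lam.rowLen i = mu.rowLen i)
    (i : ℕ) : (toggle mu kap p).rowLen i =
      if i = p then 2 * mu.rowLen p + 1 - kap.rowLen p else kap.rowLen i := by
  rw [toggle, rowLen_ofSeq (N := lam.card + p + 1)]
  · intro j
    have h1 := hv j; have h2 := hh j; have h3 := hv (j + 1); have h4 := hh (j + 1)
    have h5 := hp' (j + 1)
    have h6 := mu.rowLen_anti _ _ (Nat.le_succ j)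
    have h7 := kap.rowLen_anti _ _ (Nat.le_succ j)
    simp only [Nat.succ_eq_add_one] at h6 h7
    rcases lt_trichotomy j p with h | rfl | h
    · rw [if_neg h.ne]
      split_ifs with hj
      · rw [← hj] at hp ⊢
        omega
      · exact h7
    · rw [if_pos rfl, if_neg (by omega)]
      have := h5 (Nat.lt_succ_self _)
      omega
    · rw [if_neg (by omega), if_neg (by omega)]
      exact h7
  · rw [if_neg (by omega)]
    have h1 := rowLen_eq_zero_of_le (rowLen_card lam) (show lam.card ≤ lam.card + p + 1 by omega)
    have := hh (lam.card + p + 1)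
    omega

/-- Below row `p` the diagrams `μ`, `κ` and `λ` agree, so row `p` of `κ` may shrink to `μ_p`. It may
grow to `μ_p + 1` because `μ_p < λ_p`, and the row above stays at least as long since it has length
at least `λ_p`. -/
theorem toggle_strips {mu lam kap : YoungDiagram} (hv : IsVStrip mu kap) (hh : IsHStrip kap lam)
    {p : ℕ} (hp : mu.rowLen p < lam.rowLen p) (hp' : ∀ i, p < i → lam.rowLen i = mu.rowLen i) :
    IsVStrip mu (toggle mu kap p) ∧ IsHStrip (toggle mu kap p) lam := by
  have key := rowLen_toggle hv hh hp hp'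
  refine ⟨fun i => ?_, fun i => ?_⟩
  · rw [key]
    have := hv i
    split_ifs with h
    · subst h
      omega
    · exact this
  · rw [key]
    have := hh i; have := hv i
    split_ifs with h
    · subst h
      have := hp' (i + 1) (Nat.lt_succ_self _)
      have h6 := mu.rowLen_anti _ _ (Nat.le_succ i)
      simp only [Nat.succ_eq_add_one] at h6
      omega
    · omega

theorem toggle_toggle {mu lam kap : YoungDiagram} (hv : IsVStrip mu kap) (hh : IsHStrip kap lam)
    {p : ℕ} (hp : mu.rowLen p < lam.rowLen p) (hp' : ∀ i, p < i → lam.rowLen i = mu.rowLen i) :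
    toggle mu (toggle mu kap p) p = kap := by
  have H := toggle_strips hv hh hp hp'
  refine ext_rowLen fun i => ?_
  rw [rowLen_toggle H.1 H.2 hp hp', rowLen_toggle hv hh hp hp', rowLen_toggle hv hh hp hp',
    if_pos rfl]
  split_ifs with h
  · subst h
    have := hv i
    omega
  · rfl

theorem ang_succ (j : ℕ) : ang (j + 1) = ang j + (j + 1) := by
  have h1 : 2 ∣ j * (j + 1) := (Nat.even_mul_succ_self j).two_dvd
  have h2 : (j + 1) * (j + 1 + 1) = j * (j + 1) + 2 * (j + 1) := by ring
  rw [ang, ang, h2, Nat.add_mul_div_left _ _ two_pos]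

/-- The new cell changes `⟨j⟩` by `j + 1`, the first strip exponent by `∑_{i<p} μ_i` and the second
by `∑_{i<p} κ_i`, modulo two. All `j` cells of `κ / μ` lie above row `p`, so the last sum is
`∑_{i<p} μ_i + j` and the total change is odd. -/
theorem add_cell_sign {mu lam kap kap' : YoungDiagram} {p j : ℕ} (hv : IsVStrip mu kap)
    (hh : IsHStrip kap lam) (hv' : IsVStrip mu kap') (hh' : IsHStrip kap' lam)
    (hp' : ∀ i, p < i → lam.rowLen i = mu.rowLen i) (hkp : kap.rowLen p = mu.rowLen p)
    (hkp' : kap'.rowLen p = mu.rowLen p + 1) (hne : ∀ i, i ≠ p → kap'.rowLen i = kap.rowLen i)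
    (hj : mu.card + j = kap.card) : kap'.card = kap.card + 1 ∧
    ((ang (j + 1) + stripExp mu kap' + stripExp kap' lam : ℕ) : ZMod 2) =
      ((ang j + stripExp mu kap + stripExp kap lam + 1 : ℕ) : ZMod 2) := by
  set t := lam.card
  have hl : lam.rowLen (p + 1 + t) = 0 := rowLen_eq_zero_of_le (rowLen_card lam) (by omega)
  have hk : kap.rowLen (p + 1 + t) = 0 := by have := hh (p + 1 + t); omega
  have hk' : kap'.rowLen (p + 1 + t) = 0 := by have := hh' (p + 1 + t); omega
  have hm : mu.rowLen (p + 1 + t) = 0 := by have := hv (p + 1 + t); omega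
  have hlow : ∀ q ≤ p, ∑ i ∈ Finset.range q, kap'.rowLen i = ∑ i ∈ Finset.range q, kap.rowLen i :=
    fun q hq => Finset.sum_congr rfl fun i hi => hne i (by have := Finset.mem_range.mp hi; omega)
  have hcard : ∀ l : YoungDiagram, l.rowLen (p + 1 + t) = 0 → l.card =
      ∑ i ∈ Finset.range p, l.rowLen i + l.rowLen p +
        ∑ i ∈ Finset.range t, l.rowLen (p + 1 + i) := by
    intro l hl
    rw [card_eq_sum_rowLen l hl, Finset.sum_range_add, Finset.sum_range_succ]
  have c1 := hcard kap hk
  have c2 := hcard kap' hk'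
  have c3 := hcard mu hm
  have hk1 : ∑ i ∈ Finset.range t, kap'.rowLen (p + 1 + i) =
      ∑ i ∈ Finset.range t, kap.rowLen (p + 1 + i) :=
    Finset.sum_congr rfl fun i _ => hne _ (by omega)
  have hk2 : ∑ i ∈ Finset.range t, kap.rowLen (p + 1 + i) =
      ∑ i ∈ Finset.range t, mu.rowLen (p + 1 + i) :=
    Finset.sum_congr rfl fun i _ => by
      have := hp' (p + 1 + i) (by omega)
      have := hv (p + 1 + i); have := hh (p + 1 + i)
      omega
  have hl1 := hlow p le_rfl
  refine ⟨by omega, ?_⟩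
  have hK : ∑ i ∈ Finset.range p, kap.rowLen i = ∑ i ∈ Finset.range p, mu.rowLen i + j := by omega
  have two : (2 : ZMod 2) = 0 := rfl
  have hp1 : p ∈ Finset.range (p + 1 + t) := Finset.mem_range.mpr (by omega)
  have e1 : (stripExp mu kap' : ZMod 2) = stripExp mu kap + ∑ i ∈ Finset.range p,
      (mu.rowLen i : ZMod 2) := by
    rw [stripExp_cast (fun i => (hv' i).1) hk', stripExp_cast (fun i => (hv i).1) hk,
      ← Finset.add_sum_erase _ _ hp1, ← Finset.add_sum_erase _ _ hp1]
    have hr : ∀ i ∈ (Finset.range (p + 1 + t)).erase p,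
        ((kap'.rowLen i : ZMod 2) + mu.rowLen i) * ∑ j ∈ Finset.range i, (mu.rowLen j : ZMod 2) =
        ((kap.rowLen i : ZMod 2) + mu.rowLen i) * ∑ j ∈ Finset.range i, (mu.rowLen j : ZMod 2) :=
      fun i hi => by rw [hne i (Finset.mem_erase.mp hi).1]
    rw [Finset.sum_congr rfl hr, hkp', hkp]
    push_cast
    ring
  have e2 : (stripExp kap' lam : ZMod 2) = stripExp kap lam + ∑ i ∈ Finset.range p,
      (kap.rowLen i : ZMod 2) := by
    rw [stripExp_cast (fun i => (hh' i).1) hl, stripExp_cast (fun i => (hh i).1) hl,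
      ← Finset.add_sum_erase _ _ hp1, ← Finset.add_sum_erase _ _ hp1]
    have hr : ∀ i ∈ (Finset.range (p + 1 + t)).erase p,
        ((lam.rowLen i : ZMod 2) + kap'.rowLen i) * ∑ j ∈ Finset.range i, (kap'.rowLen j : ZMod 2) =
        ((lam.rowLen i : ZMod 2) + kap.rowLen i) * ∑ j ∈ Finset.range i, (kap.rowLen j : ZMod 2) := by
      intro i hi
      have hip := (Finset.mem_erase.mp hi).1
      rw [hne i hip]
      rcases lt_or_gt_of_ne hip with h | h
      · rw [← Nat.cast_sum, ← Nat.cast_sum, hlow i h.le]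
      -- Below row `p` the partial sums of `κ` do change, but there `λ / κ` has no cells and the
      -- summand is zero.
      · have : lam.rowLen i = kap.rowLen i := by
          have := hp' i h
          have := hv i; have := hh i
          omega
        rw [this, ← two_mul, two, zero_mul, zero_mul, zero_mul]
    rw [Finset.sum_congr rfl hr, ← Nat.cast_sum, ← Nat.cast_sum, hl1, hkp', hkp]
    push_cast
    ring
  push_cast
  rw [e1, e2, ang_succ, ← Nat.cast_sum, ← Nat.cast_sum, hK]
  push_cast
  linear_combination (∑ i ∈ Finset.range p, (mu.rowLen i : ZMod 2) + j) * two

/-! ### The alternating relation between horizontal and vertical strips -/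

section Relation

variable {k : Type*} [CommRing k]

/-- For a fixed final shape `λ`, which differs from `μ` as `n > 0`, toggling the cell of `κ` in the
last row of `λ / μ` pairs off all intermediate shapes with opposite signs. -/
theorem sum_addStrip_eq_zero {n : ℕ} (hn : 0 < n) (v : Fock k) :
    ∑ j ∈ Finset.range (n + 1), (-1 : k) ^ ang j •
      addStrip k IsHStrip (n - j) (addStrip k IsVStrip j v) = 0 := by
  classical
  induction v using Finsupp.induction_linear with
  | zero => simp
  | add v w hv hw => simp only [map_add, smul_add, Finset.sum_add_distrib, hv, hw, add_zero]
  | single mu c =>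
  rw [← mul_one c, ← smul_eq_mul, ← Finsupp.smul_single]
  simp only [map_smul, smul_comm _ c, ← Finset.smul_sum]
  refine (congrArg (c • ·) ?_).trans (smul_zero c)
  simp only [addStrip, Finsupp.linearCombination_single, one_smul, map_sum, Finset.smul_sum,
    Finsupp.smul_single, smul_eq_mul, Finset.sum_sigma', ← pow_add]
  have hspec : ∀ (j : ℕ) (kap lam : YoungDiagram), (⟨j, kap, lam⟩ : Σ _ : ℕ, Σ _ : YoungDiagram,
      YoungDiagram) ∈ (Finset.range (n + 1)).sigma (fun j =>
        ((partitions (mu.card + j)).filter (IsVStrip mu)).sigma fun kap =>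
          (partitions (kap.card + (n - j))).filter (IsHStrip kap)) →
      kap.card = mu.card + j ∧ lam.card = mu.card + n ∧ IsVStrip mu kap ∧ IsHStrip kap lam ∧
      mu.rowLen (lastRow mu lam) < lam.rowLen (lastRow mu lam) ∧
      ∀ i, lastRow mu lam < i → lam.rowLen i = mu.rowLen i := by
    intro j kap lam hp
    simp only [Finset.mem_sigma, Finset.mem_filter, mem_partitions, Finset.mem_range] at hp
    obtain ⟨h1, ⟨h2, h3⟩, h4, h5⟩ := hp
    exact ⟨h2, by omega, h3, h5, lastRow_spec (fun i => (h3 i).1.trans (h5 i).1) (by omega)⟩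
  refine Finset.sum_involution (fun p _ => ⟨(toggle mu p.2.1 (lastRow mu p.2.2)).card - mu.card,
    toggle mu p.2.1 (lastRow mu p.2.2), p.2.2⟩) ?_ ?_ ?_ ?_
  · rintro ⟨j, kap, lam⟩ hp
    obtain ⟨h1, h2, h3, h4, h5, h6⟩ := hspec j kap lam hp
    obtain ⟨h7, h8⟩ := toggle_strips h3 h4 h5 h6
    have hrow := rowLen_toggle h3 h4 h5 h6
    simp only
    rw [← Finsupp.single_add]
    have hcan : ∀ {a b : ℕ}, (a : ZMod 2) = ((b + 1 : ℕ) : ZMod 2) →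
        (-1 : k) ^ a + (-1) ^ b = 0 := by
      intro a b hab
      rw [neg_one_pow_congr hab, pow_succ]
      ring
    have h9 := h3 (lastRow mu lam)
    rcases (show kap.rowLen (lastRow mu lam) = mu.rowLen (lastRow mu lam) ∨
      kap.rowLen (lastRow mu lam) = mu.rowLen (lastRow mu lam) + 1 by omega) with h | h
    · obtain ⟨hc, hs⟩ := add_cell_sign h3 h4 h7 h8 h6 h
        (by rw [hrow, if_pos rfl]; omega) (fun i hi => by rw [hrow, if_neg hi]) h1.symm
      rw [show (toggle mu kap (lastRow mu lam)).card - mu.card = j + 1 by omega, add_comm,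
        ← add_assoc, ← add_assoc, hcan hs, Finsupp.single_zero]
    · have hc' := h7.card_le
      obtain ⟨hc, hs⟩ := add_cell_sign h7 h8 h3 h4 h6 (by rw [hrow, if_pos rfl]; omega) h
        (fun i hi => by rw [hrow, if_neg hi]) (Nat.add_sub_cancel' hc')
      rw [show (toggle mu kap (lastRow mu lam)).card - mu.card + 1 = j by omega] at hs
      rw [← add_assoc, ← add_assoc, hcan hs, Finsupp.single_zero]
  · rintro ⟨j, kap, lam⟩ hp -
    obtain ⟨h1, h2, h3, h4, h5, h6⟩ := hspec j kap lam hp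
    have hrow := rowLen_toggle h3 h4 h5 h6 (lastRow mu lam)
    rw [if_pos rfl] at hrow
    -- A fixed point would need `κ_p = 2 μ_p + 1 - κ_p`, impossible by parity.
    intro heq
    simp only [Sigma.mk.injEq, heq_eq_eq] at heq
    rw [heq.2.1] at hrow
    have := h3 (lastRow mu lam)
    omega
  · rintro ⟨j, kap, lam⟩ hp
    obtain ⟨h1, h2, h3, h4, h5, h6⟩ := hspec j kap lam hp
    obtain ⟨h7, h8⟩ := toggle_strips h3 h4 h5 h6
    have := h7.card_le
    have := h8.card_le
    simp only [Finset.mem_sigma, Finset.mem_filter, mem_partitions, Finset.mem_range]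
    refine ⟨?_, ⟨?_, h7⟩, ?_, h8⟩ <;> omega
  · rintro ⟨j, kap, lam⟩ hp
    obtain ⟨h1, h2, h3, h4, h5, h6⟩ := hspec j kap lam hp
    simp only [toggle_toggle h3 h4 h5 h6, Sigma.mk.injEq, heq_eq_eq, and_true]
    omega

end Relation

/-! ### The action of `Λ'` on the Fock space -/

section Action

variable (k : Type*) [CommRing k]

/-- The right action of `Λ'` on the Fock space in which `h_n` adds horizontal strips. -/
def fockAction : FreeLambda k →ₐ[k] (Module.End k (Fock k))ᵐᵒᵖ :=
  FreeAlgebra.lift k fun n : ℕ+ => MulOpposite.op (addStrip k IsHStrip n)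

/-- The operator on the Fock space given by an element of `Λ'`. -/
def act : FreeLambda k →ₗ[k] Module.End k (Fock k) :=
  (MulOpposite.opLinearEquiv k).symm.toLinearMap ∘ₗ (fockAction k).toLinearMap

variable {k}

/-- The opposite ring makes the left factor act first, so `e_j h_{n-j}` adds the vertical strip
before the horizontal one, as in `sum_addStrip_eq_zero`. -/
theorem act_mul (x y : FreeLambda k) (v : Fock k) : act k (x * y) v = act k y (act k x v) := by
  simp [act]

theorem act_one (v : Fock k) : act k 1 v = v := by
  simp [act]

theorem act_ι (a : ℕ+) (v : Fock k) :
    act k (FreeAlgebra.ι k a) v = addStrip k IsHStrip a v := by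
  have H : fockAction k (FreeAlgebra.ι k a) = MulOpposite.op (addStrip k IsHStrip a) :=
    FreeAlgebra.lift_ι_apply _ _
  exact LinearMap.congr_fun (congrArg MulOpposite.unop H) v

theorem act_h (n : ℕ) (v : Fock k) : act k (h k n) v = addStrip k IsHStrip n v := by
  rw [h]
  split_ifs with hn
  · exact act_ι _ v
  · rw [act_one, Nat.eq_zero_of_not_pos hn,
      addStrip_zero IsHStrip.refl fun _ _ H i => (H i).1]

/-- The action of `e_n` and the addition of vertical strips satisfy the same recursion; its terms
with `j < n` agree by induction, hence so do the last ones. -/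
theorem act_e (n : ℕ) (v : Fock k) : act k (e k n) v = addStrip k IsVStrip n v := by
  induction n using Nat.strong_induction_on with
  | _ n ih =>
  rcases Nat.eq_zero_or_pos n with rfl | hn
  · rw [e, act_one, addStrip_zero IsVStrip.refl fun _ _ H i => (H i).1]
  -- The signs in `e_relation` are elements of the algebra and have to become scalars before
  -- linearity applies.
  have hsmul : ∀ (j : ℕ) (x : FreeLambda k), (-1) ^ j * x = ((-1 : k) ^ j) • x := fun j x => by
    rcases neg_one_pow_eq_or k j with H | H <;> rcases Nat.even_or_odd j with H' | H' <;>
      simp [H'.neg_one_pow]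
  have h1 := congrArg (fun x => act k x v) (e_relation (k := k) n hn)
  simp only [hsmul, map_sum, map_smul, LinearMap.sum_apply, LinearMap.smul_apply, act_mul, act_h,
    map_zero, LinearMap.zero_apply] at h1
  have h2 := sum_addStrip_eq_zero (k := k) hn v
  rw [Finset.sum_range_succ, Nat.sub_self,
    addStrip_zero IsHStrip.refl fun _ _ H i => (H i).1] at h1 h2
  rw [Finset.sum_congr rfl fun j hj => by rw [ih j (Finset.mem_range.mp hj)], ← h2] at h1
  have h3 := congrArg (fun w => ((-1 : k) ^ ang n) • w) (add_left_cancel h1)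
  simpa only [smul_smul, ← pow_add, Even.neg_one_pow ⟨_, rfl⟩, one_smul] using h3

theorem basisFreeMonoid_apply (w : FreeMonoid ℕ+) :
    FreeAlgebra.basisFreeMonoid k ℕ+ w = FreeMonoid.lift (FreeAlgebra.ι k) w := by
  simp [FreeAlgebra.basisFreeMonoid, FreeAlgebra.equivMonoidAlgebraFreeMonoid]

theorem act_lift (w : FreeMonoid ℕ+) (v : Fock k) :
    act k (FreeMonoid.lift (FreeAlgebra.ι k) w) v =
      (wordParts w).foldl (fun v b => addStrip k IsHStrip b v) v := by
  induction w using FreeMonoid.inductionOn' generalizing v with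
  | one => rw [map_one, act_one]; rfl
  | of_mul a w ih =>
    rw [map_mul, FreeMonoid.lift_eval_of, act_mul, ih, act_ι]
    rfl

/-- By bilinearity it suffices to compare words, where this is `fockForm_wordVec`. -/
theorem freeForm_eq (x y : FreeLambda k) :
    freeForm (-1 : k) x y =
      fockForm k (act k x (Finsupp.single ⊥ 1)) (act k y (Finsupp.single ⊥ 1)) := by
  let phi : FreeLambda k →ₗ[k] Fock k := LinearMap.flip (act k) (Finsupp.single ⊥ 1)
  have H : freeForm (-1 : k) = (fockForm k).compl₁₂ phi phi := by
    refine (FreeAlgebra.basisFreeMonoid k ℕ+).ext fun v => ?_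
    refine (FreeAlgebra.basisFreeMonoid k ℕ+).ext fun w => ?_
    simp only [freeForm, Module.Basis.constr_basis, LinearMap.compl₁₂_apply]
    rw [basisFreeMonoid_apply, basisFreeMonoid_apply, ← fockForm_wordVec, LinearMap.flip_apply,
      LinearMap.flip_apply, act_lift, act_lift]
    rfl
  exact LinearMap.congr_fun (LinearMap.congr_fun H x) y

theorem act_prod_e (l : List ℕ) (v : Fock k) :
    act k (l.map (e k)).prod v = l.foldl (fun v b => addStrip k IsVStrip b v) v := by
  induction l generalizing v with
  | nil => exact act_one v
  | cons a l ih => rw [List.map_cons, List.prod_cons, act_mul, ih, act_e, List.foldl_cons]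

/-- The form on `Λ` is evaluated on representatives in `Λ'`, so the action never has to descend to
the quotient. -/
theorem Mdd_eq (mu rho : YoungDiagram) : Mdd k mu rho =
    fockForm k (mu.rowLens.foldl (fun v b => addStrip k IsVStrip b v) (Finsupp.single ⊥ 1))
      (rho.rowLens.foldl (fun v b => addStrip k IsVStrip b v) (Finsupp.single ⊥ 1)) := by
  rw [Mdd, ePart, ePart, form_mk, freeForm_eq, act_prod_e, act_prod_e]

end Action

/-! ### Inversions of words -/

/-- Every sorting permutation must invert each inversion of the word, and the stable sort inverts
nothing else. -/
theorem sortLength_eq (w : List ℕ) :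
    sortLength w = (Finset.univ.filter fun p : Fin w.length × Fin w.length =>
      p.1 < p.2 ∧ w.get p.2 < w.get p.1).card := by
  refine le_antisymm ?_ ?_
  -- Used for the sort itself, the characterisation yields its stability `h2`: equal letters keep
  -- their order.
  · obtain ⟨h1, h2⟩ := Tuple.eq_sort_iff.mp (rfl : Tuple.sort w.get = Tuple.sort w.get)
    have hle : sortLength w ≤ permLength (Tuple.sort w.get) :=
      Nat.sInf_le ⟨Tuple.sort w.get, h1, rfl⟩
    refine hle.trans ?_
    refine Finset.card_le_card_of_injOn
      (fun p => (Tuple.sort w.get p.2, Tuple.sort w.get p.1)) ?_ ?_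
    · intro p hp
      simp only [Finset.coe_filter, Finset.mem_univ, true_and, Set.mem_ofPred_eq] at hp ⊢
      refine ⟨hp.2, lt_of_le_of_ne (h1 hp.1.le) fun heq => ?_⟩
      exact lt_asymm hp.2 (h2 _ _ hp.1 heq)
    · intro p _ q _ hpq
      simp only [Prod.mk.injEq, EmbeddingLike.apply_eq_iff_eq] at hpq
      exact Prod.ext hpq.2 hpq.1
  · refine le_csInf ⟨_, Tuple.sort w.get, Tuple.monotone_sort w.get, rfl⟩ ?_
    rintro l ⟨σ, hσ, rfl⟩
    refine Finset.card_le_card_of_injOn (fun p => (σ⁻¹ p.2, σ⁻¹ p.1)) ?_ ?_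
    · intro p hp
      simp only [Finset.coe_filter, Finset.mem_univ, true_and, Set.mem_ofPred_eq] at hp ⊢
      have hi : ∀ x, σ (σ⁻¹ x) = x := σ.apply_symm_apply
      refine ⟨hσ.reflect_lt ?_, ?_⟩
      · simp only [hi]
        exact hp.2
      · simp only [hi]
        exact hp.1
    · intro p _ q _ hpq
      simp only [Prod.mk.injEq, EmbeddingLike.apply_eq_iff_eq] at hpq
      exact Prod.ext hpq.2 hpq.1

/-- The number of inversions of a word. -/
def listInv : List ℕ → ℕ
  | [] => 0
  | a :: l => (l.map fun b => if b < a then 1 else 0).sum + listInv l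

theorem sortLength_eq_listInv (w : List ℕ) : sortLength w = listInv w := by
  rw [sortLength_eq, Finset.card_filter, Fintype.sum_prod_type]
  induction w with
  | nil => rfl
  | cons a l ih =>
    rw [listInv, ← ih]
    have h1 : (l.map fun b => if b < a then 1 else 0).sum =
        ∑ q : Fin l.length, if l.get q < a then 1 else 0 :=
      (Fin.sum_univ_fun_getElem l fun b => if b < a then 1 else 0).symm
    rw [h1]
    simp only [List.length_cons, Fin.sum_univ_succ, Fin.not_lt_zero, false_and, if_false, zero_add,
      Fin.succ_pos, true_and, Fin.succ_lt_succ_iff]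
    rfl

theorem listInv_append (l l' : List ℕ) : listInv (l ++ l') =
    listInv l + (l.map fun a => (l'.map fun b => if b < a then 1 else 0).sum).sum + listInv l' := by
  induction l with
  | nil => simp [listInv]
  | cons a l ih =>
    simp only [List.cons_append, listInv, List.map_append, List.sum_append, ih, List.map_cons,
      List.sum_cons]
    omega

theorem listInv_of_sorted {l : List ℕ} (H : l.Pairwise (· ≤ ·)) : listInv l = 0 := by
  induction l with
  | nil => rfl
  | cons a l ih =>
    rw [List.pairwise_cons] at H
    rw [listInv, ih H.2, add_zero, List.sum_eq_zero]
    intro x hx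
    obtain ⟨b, hb, rfl⟩ := List.mem_map.mp hx
    rw [if_neg (not_lt.mpr (H.1 b hb))]

theorem sum_map_range {M : Type*} [AddCommMonoid M] (n : ℕ) (f : ℕ → M) :
    ((List.range n).map f).sum = ∑ j ∈ Finset.range n, f j := by
  rw [Finset.sum_range, ← List.sum_ofFn, List.ofFn_eq_map, ← List.map_coe_finRange_eq_range, List.map_map]
  rfl

theorem sum_map_flatMap_rows (row : ℕ → List ℕ) (f : ℕ → ℕ) (m : ℕ) :
    ((((List.range m).reverse.flatMap row)).map f).sum =
      ∑ i ∈ Finset.range m, ((row i).map f).sum := by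
  induction m with
  | zero => simp
  | succ m ih =>
    rw [List.range_succ, List.reverse_append, List.reverse_singleton, List.singleton_append,
      List.flatMap_cons, List.map_append, List.sum_append, ih, Finset.sum_range_succ, add_comm]

/-- Sorted rows have no inversions of their own. Lower rows are read first, so an inversion is a
larger entry in a lower row. -/
theorem listInv_flatMap_rows (row : ℕ → List ℕ) (hrow : ∀ i, (row i).Pairwise (· ≤ ·)) (m : ℕ) :
    listInv ((List.range m).reverse.flatMap row) =
      ∑ i ∈ Finset.range m, ((row i).map fun a => ∑ i' ∈ Finset.range i,
        ((row i').map fun b => if b < a then 1 else 0).sum).sum := by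
  induction m with
  | zero => rfl
  | succ m ih =>
    rw [List.range_succ, List.reverse_append, List.reverse_singleton, List.singleton_append,
      List.flatMap_cons, listInv_append, listInv_of_sorted (hrow m), zero_add, ih,
      Finset.sum_range_succ, add_comm]
    simp only [sum_map_flatMap_rows]

/-- The number of pairs of cells with the larger entry in a strictly lower row. -/
def rowInv (lam : YoungDiagram) (T : ℕ → ℕ → ℕ) : ℕ :=
  ∑ x ∈ lam.cells, ∑ y ∈ lam.cells, if y.1 < x.1 ∧ T y.1 y.2 < T x.1 x.2 then 1 else 0

theorem sortLength_rowWord {lam : YoungDiagram} (T : SemistandardYoungTableau lam) :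
    sortLength (rowWord T) = rowInv lam T := by
  have hrow : ∀ i, ((List.range (lam.rowLen i)).map fun j => T i j).Pairwise (· ≤ ·) := by
    intro i
    rw [List.pairwise_map]
    refine List.Pairwise.imp_of_mem ?_ (List.pairwise_lt_range (n := lam.rowLen i))
    intro j j' _ hj' hlt
    exact T.row_weak hlt (YoungDiagram.mem_iff_lt_rowLen.mpr (List.mem_range.mp hj'))
  rw [sortLength_eq_listInv, rowWord, listInv_flatMap_rows _ hrow, rowInv,
    sum_cells lam (rowLen_colLen lam)]
  refine Finset.sum_congr rfl fun i hi => ?_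
  rw [List.map_map, sum_map_range]
  refine Finset.sum_congr rfl fun j _ => ?_
  rw [sum_cells lam (rowLen_colLen lam)]
  simp only [Function.comp_def, List.map_map, sum_map_range]
  have hsub : Finset.range i ⊆ Finset.range (lam.colLen 0) :=
    Finset.range_mono (Finset.mem_range.mp hi).le
  rw [← Finset.sum_subset hsub]
  · refine Finset.sum_congr rfl fun i' hi' => Finset.sum_congr rfl fun j' _ => ?_
    simp only [Finset.mem_range.mp hi', true_and]
  · intro i' _ hi'
    refine Finset.sum_eq_zero fun j' _ => if_neg fun H => hi' (Finset.mem_range.mpr H.1)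

/-! ### Column tableaux as chains of vertical strips -/

/-- `T` is a filling of `λ` (and zero elsewhere) with strictly increasing rows and weakly increasing
columns. -/
structure IsColTab (lam : YoungDiagram) (T : ℕ → ℕ → ℕ) : Prop where
  row : ∀ {i j j'}, j < j' → (i, j') ∈ lam → T i j < T i j'
  col : ∀ {i i' j}, i < i' → (i', j) ∈ lam → T i j ≤ T i' j
  zeros : ∀ {i j}, (i, j) ∉ lam → T i j = 0

open scoped Classical in
/-- Extend a filling of `κ` to `λ` by the letter `r`. -/
def extend (kap lam : YoungDiagram) (r : ℕ) (T : ℕ → ℕ → ℕ) : ℕ → ℕ → ℕ := fun i j =>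
  if (i, j) ∈ lam ∧ (i, j) ∉ kap then r else T i j

open scoped Classical in
/-- The column tableaux of shape `λ` with `cont i` letters `i` for `i < r`, and no others. -/
def colTabs (cont : ℕ → ℕ) : ℕ → YoungDiagram → Finset (ℕ → ℕ → ℕ)
  | 0, lam => if lam = ⊥ then {0} else ∅
  | r + 1, lam => ((partitions (lam.card - cont r)).filter fun kap =>
      kap.card + cont r = lam.card ∧ IsVStrip kap lam).biUnion fun kap =>
        (colTabs cont r kap).image (extend kap lam r)

/-- The cells of a column tableau with entries less than `r`. -/
def IsColTab.below {lam : YoungDiagram} {T : ℕ → ℕ → ℕ} (H : IsColTab lam T) (r : ℕ) :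
    YoungDiagram where
  cells := lam.cells.filter fun c => T c.1 c.2 < r
  isLowerSet := by
    rintro ⟨i, j⟩ ⟨i', j'⟩ ⟨hi, hj⟩ hm
    simp only [Finset.coe_filter, YoungDiagram.mem_cells, Set.mem_ofPred_eq] at *
    refine ⟨lam.up_left_mem hi hj hm.1, lt_of_le_of_lt ?_ hm.2⟩
    have h1 : T i' j' ≤ T i' j := by
      rcases eq_or_lt_of_le hj with rfl | hj
      · exact le_rfl
      · exact (H.row hj (lam.up_left_mem hi le_rfl hm.1)).le
    refine h1.trans ?_
    rcases eq_or_lt_of_le hi with rfl | hi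
    · exact le_rfl
    · exact H.col hi hm.1

theorem IsColTab.mem_below {lam : YoungDiagram} {T : ℕ → ℕ → ℕ} (H : IsColTab lam T) {r : ℕ}
    {c : ℕ × ℕ} : c ∈ H.below r ↔ c ∈ lam ∧ T c.1 c.2 < r := by
  rw [← YoungDiagram.mem_cells, IsColTab.below, Finset.mem_filter, YoungDiagram.mem_cells]

theorem mem_of_rowLen_le {kap lam : YoungDiagram} (hle : ∀ i, kap.rowLen i ≤ lam.rowLen i)
    {c : ℕ × ℕ} (hc : c ∈ kap) : c ∈ lam := by
  obtain ⟨i, j⟩ := c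
  rw [YoungDiagram.mem_iff_lt_rowLen] at hc ⊢
  exact hc.trans_le (hle i)

/-- Induction by stripping off the largest letter: strict rows contain it at most once, so its cells
form a vertical strip over the diagram of smaller entries. -/
theorem mem_colTabs {cont : ℕ → ℕ} {r : ℕ} {lam : YoungDiagram} {T : ℕ → ℕ → ℕ} :
    T ∈ colTabs cont r lam ↔ IsColTab lam T ∧ (∀ c ∈ lam.cells, T c.1 c.2 < r) ∧
      ∀ i < r, (lam.cells.filter fun c => T c.1 c.2 = i).card = cont i := by
  classical
  induction r generalizing lam T with
  | zero =>
    rw [colTabs]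
    constructor
    · intro hT
      split_ifs at hT with hl
      · subst hl
        rw [Finset.mem_singleton] at hT
        subst hT
        exact ⟨⟨fun _ H => absurd H (YoungDiagram.notMem_bot _),
          fun _ H => absurd H (YoungDiagram.notMem_bot _), fun _ => rfl⟩,
          fun c hc => absurd hc (YoungDiagram.notMem_bot _), fun i hi => absurd hi (Nat.not_lt_zero _)⟩
      · exact absurd hT (Finset.notMem_empty _)
    · rintro ⟨h1, h2, -⟩
      have hl : lam = ⊥ := by
        refine YoungDiagram.ext (Finset.eq_empty_of_forall_notMem fun c hc => ?_)
        exact Nat.not_lt_zero _ (h2 c hc)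
      rw [if_pos hl, Finset.mem_singleton]
      subst hl
      funext i j
      exact h1.zeros (YoungDiagram.notMem_bot _)
  | succ r ih =>
    simp only [colTabs, Finset.mem_biUnion, Finset.mem_filter, mem_partitions, Finset.mem_image]
    constructor
    · rintro ⟨kap, ⟨-, hc, hv⟩, T, hT, rfl⟩
      obtain ⟨h1, h2, h3⟩ := ih.mp hT
      have hsub : ∀ {c}, c ∈ kap → c ∈ lam := mem_of_rowLen_le fun i => (hv i).1
      have hin : ∀ {i j}, (i, j) ∈ kap → extend kap lam r T i j = T i j := fun hk =>
        if_neg fun H => H.2 hk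
      have hout : ∀ {i j}, (i, j) ∈ lam → (i, j) ∉ kap → extend kap lam r T i j = r :=
        fun hl hk => if_pos ⟨hl, hk⟩
      have hzero : ∀ {i j}, (i, j) ∉ lam → extend kap lam r T i j = 0 := fun hl =>
        (if_neg fun H => hl H.1).trans (h1.zeros fun H => hl (hsub H))
      have hle : ∀ i j, extend kap lam r T i j ≤ r := by
        intro i j
        by_cases hk : (i, j) ∈ kap
        · rw [hin hk]
          exact (h2 _ hk).le
        · by_cases hl : (i, j) ∈ lam
          · rw [hout hl hk]
          · rw [hzero hl]
            exact Nat.zero_le _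
      refine ⟨⟨?_, ?_, hzero⟩, fun c _ => Nat.lt_succ_of_le (hle _ _), ?_⟩
      · intro i j j' hj hm
        by_cases hk : (i, j') ∈ kap
        · rw [hin hk, hin (kap.up_left_mem le_rfl hj.le hk)]
          exact h1.row hj hk
        · have hk' : (i, j) ∈ kap := by
            rw [YoungDiagram.mem_iff_lt_rowLen] at hm hk ⊢
            have := hv i
            omega
          rw [hout hm hk, hin hk']
          exact h2 _ hk'
      · intro i i' j hi hm
        by_cases hk : (i', j) ∈ kap
        · rw [hin hk, hin (kap.up_left_mem hi.le le_rfl hk)]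
          exact h1.col hi hk
        · rw [hout hm hk]
          exact hle _ _
      · intro i hi
        rcases Nat.lt_succ_iff_lt_or_eq.mp hi with hi | rfl
        · rw [← h3 i hi]
          congr 1
          ext ⟨a, b⟩
          simp only [Finset.mem_filter, YoungDiagram.mem_cells]
          constructor
          · rintro ⟨hm, he⟩
            by_cases hk : (a, b) ∈ kap
            · exact ⟨hk, (hin hk).symm.trans he⟩
            · rw [hout hm hk] at he
              omega
          · rintro ⟨hk, he⟩
            exact ⟨hsub hk, (hin hk).trans he⟩
        · have : lam.cells.filter (fun c => extend kap lam i T c.1 c.2 = i) =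
              lam.cells \ kap.cells := by
            ext ⟨a, b⟩
            simp only [Finset.mem_filter, Finset.mem_sdiff, YoungDiagram.mem_cells]
            refine and_congr_right fun hm => ⟨fun he hk => ?_, fun hk => hout hm hk⟩
            rw [hin hk] at he
            exact (h2 _ hk).ne he
          rw [this, Finset.card_sdiff_of_subset (fun c hc => hsub hc)]
          change lam.card - kap.card = _
          omega
    · rintro ⟨h1, h2, h3⟩
      have hb := fun {c : ℕ × ℕ} => h1.mem_below (r := r) (c := c)
      have hcard : (h1.below r).card + cont r = lam.card := by
        rw [← h3 r (Nat.lt_succ_self r)]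
        have hr : lam.cells.filter (fun c => T c.1 c.2 = r) =
            lam.cells.filter fun c => ¬ T c.1 c.2 < r :=
          Finset.filter_congr fun c hc => by have := h2 c hc; omega
        rw [hr]
        exact Finset.card_filter_add_card_filter_not _
      have hv : IsVStrip (h1.below r) lam := by
        intro i
        constructor
        · by_contra hc
          have hm : (i, lam.rowLen i) ∈ h1.below r :=
            YoungDiagram.mem_iff_lt_rowLen.mpr (not_le.mp hc)
          exact lt_irrefl _ (YoungDiagram.mem_iff_lt_rowLen.mp (hb.mp hm).1)
        -- Two cells of a row outside the smaller diagram would carry letters at least `r` and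
        -- strictly increasing, but `r` is the largest letter.
        · by_contra hc
          set a := (h1.below r).rowLen i with ha
          have hm : (i, a + 1) ∈ lam := YoungDiagram.mem_iff_lt_rowLen.mpr (not_le.mp hc)
          have hn : (i, a) ∉ h1.below r := fun hn =>
            lt_irrefl _ (YoungDiagram.mem_iff_lt_rowLen.mp hn)
          have h4 := h1.row (Nat.lt_succ_self a) hm
          have h5 := h2 _ hm
          simp only [Nat.succ_eq_add_one] at h4 h5
          exact hn (hb.mpr ⟨lam.up_left_mem le_rfl (Nat.le_succ a) hm, by simp only; omega⟩)
      refine ⟨h1.below r, ⟨by omega, hcard, hv⟩,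
        fun i j => if (i, j) ∈ h1.below r then T i j else 0, ?_, ?_⟩
      · rw [ih]
        refine ⟨⟨?_, ?_, fun hk => if_neg hk⟩, ?_, ?_⟩
        · intro i j j' hj hm
          rw [if_pos hm, if_pos ((h1.below r).up_left_mem le_rfl hj.le hm)]
          exact h1.row hj (hb.mp hm).1
        · intro i i' j hi hm
          rw [if_pos hm, if_pos ((h1.below r).up_left_mem hi.le le_rfl hm)]
          exact h1.col hi (hb.mp hm).1
        · intro c hc
          rw [YoungDiagram.mem_cells] at hc
          rw [if_pos hc]
          exact (hb.mp hc).2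
        · intro i hi
          rw [← h3 i (Nat.lt_succ_of_lt hi)]
          congr 1
          ext c
          simp only [Finset.mem_filter, YoungDiagram.mem_cells]
          constructor
          · rintro ⟨hm, he⟩
            rw [if_pos hm] at he
            exact ⟨(hb.mp hm).1, he⟩
          · rintro ⟨hm, he⟩
            have hm' : c ∈ h1.below r := hb.mpr ⟨hm, he ▸ hi⟩
            exact ⟨hm', by rw [if_pos hm', he]⟩
      · funext i j
        rw [extend]
        by_cases hl : (i, j) ∈ lam
        · by_cases hk : (i, j) ∈ h1.below r
          · rw [if_neg fun H => H.2 hk, if_pos hk]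
          · rw [if_pos ⟨hl, hk⟩]
            have h4 := h2 _ hl
            have h5 : ¬ T i j < r := fun h5 => hk (hb.mpr ⟨hl, h5⟩)
            simp only at h4
            omega
        · rw [if_neg fun H => hl H.1, if_neg fun H => hl (hb.mp H).1, h1.zeros hl]

/-! ### Coefficients of iterated vertical strips as signed sums over column tableaux -/

section Coefficients

variable {k : Type*} [CommRing k]

open scoped Classical in
theorem addStrip_apply (R : YoungDiagram → YoungDiagram → Prop) (b : ℕ) (v : Fock k)
    (lam : YoungDiagram) : addStrip k R b v lam =
      ∑ kap ∈ (partitions (lam.card - b)).filter (fun kap => kap.card + b = lam.card ∧ R kap lam),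
        v kap * (-1) ^ stripExp kap lam := by
  induction v using Finsupp.induction_linear with
  | zero => simp
  | add v w hv hw => simp only [map_add, Finsupp.add_apply, hv, hw, add_mul, Finset.sum_add_distrib]
  | single mu c =>
  simp only [addStrip, Finsupp.linearCombination_single, Finsupp.smul_apply,
    Finsupp.finsetSum_apply, Finsupp.single_apply, smul_eq_mul, Finset.sum_ite_eq',
    Finset.mem_filter, mem_partitions, ite_mul, zero_mul, Finset.sum_ite_eq]
  by_cases H : lam.card = mu.card + b ∧ R mu lam
  · rw [if_pos H, if_pos ⟨by omega, by omega, H.2⟩]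
  · rw [if_neg H, if_neg (fun H' => H ⟨by omega, H'.2.2⟩), mul_zero]

theorem sum_cells_row_lt (kap : YoungDiagram) (i : ℕ) :
    (∑ y ∈ kap.cells, if y.1 < i then 1 else 0) = ∑ j ∈ Finset.range i, kap.rowLen j := by
  have h0 := rowLen_eq_zero_of_le (rowLen_card kap) (Nat.le_add_right _ i)
  rw [sum_cells kap h0]
  have hsub : Finset.range i ⊆ Finset.range (kap.card + i) := Finset.range_mono (by omega)
  rw [← Finset.sum_subset hsub]
  · refine Finset.sum_congr rfl fun j hj => ?_
    simp [Finset.mem_range.mp hj]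
  · intro j _ hj
    simp only [Finset.mem_range] at hj
    simp [hj]

/-- The new letter exceeds all old ones, so each new cell creates one inversion with every cell of
`κ` in a higher row and no others. Modulo two, this number is `stripExp`. -/
theorem rowInv_extend {kap lam : YoungDiagram} {r : ℕ} {T : ℕ → ℕ → ℕ} (hv : IsVStrip kap lam)
    (hT : ∀ c ∈ kap.cells, T c.1 c.2 < r) :
    (rowInv lam (extend kap lam r T) : ZMod 2) = rowInv kap T + stripExp kap lam := by
  classical
  have hsub : kap.cells ⊆ lam.cells := fun c hc => mem_of_rowLen_le (fun i => (hv i).1) hc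
  have hin : ∀ c ∈ kap.cells, extend kap lam r T c.1 c.2 = T c.1 c.2 := fun c hk =>
    if_neg fun H => H.2 hk
  have hout : ∀ c ∈ lam.cells \ kap.cells, extend kap lam r T c.1 c.2 = r := fun c hc =>
    if_pos (Finset.mem_sdiff.mp hc)
  have hle : ∀ c ∈ lam.cells, extend kap lam r T c.1 c.2 ≤ r := by
    intro c hc
    by_cases hk : c ∈ kap.cells
    · rw [hin c hk]
      exact (hT c hk).le
    · exact (hout c (Finset.mem_sdiff.mpr ⟨hc, hk⟩)).le
  have h1 : ∀ x ∈ kap.cells, (∑ y ∈ lam.cells, if y.1 < x.1 ∧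
      extend kap lam r T y.1 y.2 < extend kap lam r T x.1 x.2 then 1 else 0) =
      ∑ y ∈ kap.cells, if y.1 < x.1 ∧ T y.1 y.2 < T x.1 x.2 then 1 else 0 := by
    intro x hx
    rw [← Finset.sum_subset hsub]
    · refine Finset.sum_congr rfl fun y hy => ?_
      rw [hin x hx, hin y hy]
    · intro y hy hy'
      rw [hout y (Finset.mem_sdiff.mpr ⟨hy, hy'⟩), hin x hx]
      exact if_neg fun H => lt_asymm H.2 (hT x hx)
  have h2 : ∀ x ∈ lam.cells \ kap.cells, (∑ y ∈ lam.cells, if y.1 < x.1 ∧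
      extend kap lam r T y.1 y.2 < extend kap lam r T x.1 x.2 then 1 else 0) =
      ∑ j ∈ Finset.range x.1, kap.rowLen j := by
    intro x hx
    rw [← sum_cells_row_lt, ← Finset.sum_subset hsub]
    · refine Finset.sum_congr rfl fun y hy => ?_
      rw [hout x hx, hin y hy]
      simp only [hT y hy, and_true]
    · intro y hy hy'
      rw [hout y (Finset.mem_sdiff.mpr ⟨hy, hy'⟩), hout x hx]
      simp
  have h3 : rowInv lam (extend kap lam r T) = ∑ x ∈ lam.cells \ kap.cells,
      ∑ j ∈ Finset.range x.1, kap.rowLen j + rowInv kap T := by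
    rw [rowInv, ← Finset.sum_sdiff hsub, Finset.sum_congr rfl h1, Finset.sum_congr rfl h2]
    rfl
  have hN := rowLen_card lam
  have hN' : kap.rowLen lam.card = 0 := by have := hv lam.card; omega
  have h4 := Finset.sum_sdiff (f := fun x : ℕ × ℕ => ∑ j ∈ Finset.range x.1, kap.rowLen j) hsub
  rw [sum_cells kap hN', sum_cells lam hN] at h4
  simp only [Finset.sum_const, Finset.card_range, smul_eq_mul] at h4
  have h5 := congrArg (fun x : ℕ => (x : ZMod 2)) h4
  have h6 := stripExp_cast (fun i => (hv i).1) hN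
  rw [h3, h6]
  have two : (2 : ZMod 2) = 0 := rfl
  push_cast at h5 ⊢
  simp only [add_mul, Finset.sum_add_distrib]
  linear_combination h5 - (∑ i ∈ Finset.range lam.card, (kap.rowLen i : ZMod 2) *
    ∑ j ∈ Finset.range i, (kap.rowLen j : ZMod 2)) * two

theorem foldl_addStrip_apply (cont : ℕ → ℕ) (r : ℕ) (lam : YoungDiagram) :
    (((List.range r).map cont).foldl (fun v b => addStrip k IsVStrip b v)
      (Finsupp.single ⊥ 1)) lam = ∑ T ∈ colTabs cont r lam, (-1) ^ rowInv lam T := by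
  classical
  induction r generalizing lam with
  | zero =>
    rw [List.range_zero, List.map_nil, List.foldl_nil, colTabs, Finsupp.single_apply]
    by_cases hl : lam = ⊥
    · subst hl
      rw [if_pos rfl, if_pos rfl, Finset.sum_singleton]
      exact (pow_zero _).symm
    · rw [if_neg (Ne.symm hl), if_neg hl, Finset.sum_empty]
  | succ r ih =>
    rw [List.range_succ, List.map_append, List.foldl_append]
    simp only [List.map_cons, List.map_nil, List.foldl_cons, List.foldl_nil]
    rw [addStrip_apply, colTabs, Finset.sum_biUnion]
    · refine Finset.sum_congr rfl fun kap hkap => ?_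
      rw [Finset.mem_filter] at hkap
      rw [ih, Finset.sum_mul, Finset.sum_image]
      · refine Finset.sum_congr rfl fun T hT => ?_
        rw [← pow_add]
        refine neg_one_pow_congr ?_
        rw [rowInv_extend hkap.2.2 (mem_colTabs.mp hT).2.1, Nat.cast_add]
      · intro T hT T' hT' heq
        funext i j
        by_cases hk : (i, j) ∈ kap
        · have := congrFun (congrFun heq i) j
          rwa [extend, extend, if_neg fun H => H.2 hk, if_neg fun H => H.2 hk] at this
        · rw [(mem_colTabs.mp hT).1.zeros hk, (mem_colTabs.mp hT').1.zeros hk]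
    · intro kap hkap kap' hkap' hne
      rw [Function.onFun, Finset.disjoint_left]
      intro T hT hT'
      refine hne ?_
      rw [Finset.mem_coe, Finset.mem_filter] at hkap hkap'
      -- The smaller diagram is recovered from the tableau as the cells with entries below `r`, so
      -- different diagrams give disjoint families.
      have key : ∀ {kap : YoungDiagram}, IsVStrip kap lam →
          T ∈ (colTabs cont r kap).image (extend kap lam r) →
          kap.cells = lam.cells.filter fun c => T c.1 c.2 < r := by
        intro kap hv hT
        obtain ⟨T₀, hT₀, rfl⟩ := Finset.mem_image.mp hT
        ext c
        rw [Finset.mem_filter]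
        constructor
        · intro hc
          refine ⟨mem_of_rowLen_le (fun i => (hv i).1) hc, ?_⟩
          rw [extend, if_neg fun H => H.2 hc]
          exact (mem_colTabs.mp hT₀).2.1 c hc
        · rintro ⟨hl, hc⟩
          by_contra hk
          rw [extend, if_pos ⟨hl, hk⟩] at hc
          exact lt_irrefl _ hc
      exact YoungDiagram.ext ((key hkap.2.2 hT).trans (key hkap'.2.2 hT').symm)

end Coefficients

/-! ### Transposed tableaux -/

theorem sum_cells_transpose {M : Type*} [AddCommMonoid M] (lam : YoungDiagram) (f : ℕ × ℕ → M) :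
    ∑ c ∈ lam.transpose.cells, f c = ∑ c ∈ lam.cells, f c.swap := by
  refine Finset.sum_bij' (fun c _ => c.swap) (fun c _ => c.swap) ?_ ?_ ?_ ?_ ?_
  · intro c hc
    rwa [YoungDiagram.mem_cells, YoungDiagram.mem_transpose] at hc
  · intro c hc
    rw [YoungDiagram.mem_cells, YoungDiagram.mem_transpose, Prod.swap_swap]
    exact hc
  all_goals intros; simp

theorem card_filter_transpose (lam : YoungDiagram) (T : ℕ → ℕ → ℕ) (i : ℕ) :
    (lam.transpose.cells.filter fun c => T c.1 c.2 = i).card =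
      (lam.cells.filter fun c => T c.2 c.1 = i).card := by
  rw [Finset.card_filter, sum_cells_transpose, Finset.card_filter]
  rfl

theorem rowLen_eq_zero_iff {lam : YoungDiagram} {i : ℕ} :
    lam.rowLen i = 0 ↔ lam.colLen 0 ≤ i := by
  rw [← not_lt, ← YoungDiagram.mem_iff_lt_colLen, YoungDiagram.mem_iff_lt_rowLen]
  omega

/-- Content `μ` forbids letters from `μ.colLen 0` on, since those rows of `μ` are empty; this is the
bound on entries built into `colTabs`. -/
theorem sum_tableaux_transpose {M : Type*} [AddCommMonoid M] (lam mu : YoungDiagram)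
    (F : (ℕ → ℕ → ℕ) → M) :
    ∑ T ∈ tableaux lam.transpose mu, F (fun i j => T j i) =
      ∑ T ∈ colTabs mu.rowLen (mu.colLen 0) lam, F T := by
  have hmem : ∀ {i j}, (j, i) ∈ lam.transpose ↔ (i, j) ∈ lam := YoungDiagram.mem_transpose
  refine Finset.sum_bij (fun T _ i j => T j i) ?_ ?_ ?_ (fun _ _ => rfl)
  · intro T hT
    have hT' : HasContent T mu := by simpa [tableaux] using hT
    have hc : ∀ i, (lam.cells.filter fun c => T c.2 c.1 = i).card = mu.rowLen i := fun i => by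
      rw [← card_filter_transpose]
      exact hT' i
    rw [mem_colTabs]
    refine ⟨⟨fun hj hm => T.col_strict hj (hmem.mpr hm),
      fun hi hm => T.row_weak hi (hmem.mpr hm), fun hm => T.zeros fun H => hm (hmem.mp H)⟩,
      fun c hc' => ?_, fun i _ => hc i⟩
    by_contra hlt
    have h0 := hc (T c.2 c.1)
    rw [rowLen_eq_zero_iff.mpr (not_lt.mp hlt), Finset.card_eq_zero] at h0
    exact Finset.notMem_empty c (h0 ▸ Finset.mem_filter.mpr ⟨hc', rfl⟩)
  · intro T _ T' _ heq
    refine SemistandardYoungTableau.ext fun i j => ?_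
    exact congrFun (congrFun heq j) i
  · intro T hT
    obtain ⟨h1, h2, h3⟩ := mem_colTabs.mp hT
    let S : SemistandardYoungTableau lam.transpose :=
      { entry := fun i j => T j i
        row_weak' := fun hj hm => h1.col hj (hmem.mp hm)
        col_strict' := fun hi hm => h1.row hi (hmem.mp hm)
        zeros' := fun hm => h1.zeros fun H => hm (hmem.mpr H) }
    have hS : HasContent S mu := by
      intro i
      rw [card_filter_transpose]
      change (lam.cells.filter fun c => T c.1 c.2 = i).card = _
      rcases lt_or_ge i (mu.colLen 0) with hi | hi
      · exact h3 i hi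
      · rw [rowLen_eq_zero_iff.mpr hi, Finset.card_eq_zero, Finset.filter_eq_empty_iff]
        intro c hc heq
        have := h2 c hc
        omega
    exact ⟨S, by simpa [tableaux] using hS, rfl⟩

theorem rowInv_transpose (lam : YoungDiagram) (T : ℕ → ℕ → ℕ) :
    rowInv lam.transpose T = ∑ x ∈ lam.cells, ∑ y ∈ lam.cells,
      if y.2 < x.2 ∧ T y.2 y.1 < T x.2 x.1 then 1 else 0 := by
  rw [rowInv, sum_cells_transpose]
  refine Finset.sum_congr rfl fun x _ => ?_
  rw [sum_cells_transpose]
  rfl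

/-! ### Comparison of the signs of a tableau and of its chain of strips -/

theorem two_mul_ang (m : ℕ) : 2 * ang m = m * (m + 1) :=
  Nat.mul_div_cancel' (Nat.even_mul_succ_self m).two_dvd

theorem angPart_eq (lam : YoungDiagram) :
    angPart lam = ∑ i ∈ Finset.range (lam.colLen 0), ang (lam.rowLen i) := by
  rw [angPart, YoungDiagram.rowLens, List.map_map, sum_map_range]
  rfl

/-- The number of pairs of cells in different rows with equal entries. -/
def equalPairs (lam : YoungDiagram) (T : ℕ → ℕ → ℕ) : ℕ :=
  ∑ x ∈ lam.cells, ∑ y ∈ lam.cells, if y.1 < x.1 ∧ T y.1 y.2 = T x.1 x.2 then 1 else 0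

theorem card_of_mem_colTabs {cont : ℕ → ℕ} {r : ℕ} {lam : YoungDiagram} {T : ℕ → ℕ → ℕ}
    (hT : T ∈ colTabs cont r lam) : lam.card = ∑ i ∈ Finset.range r, cont i := by
  obtain ⟨-, h2, h3⟩ := mem_colTabs.mp hT
  rw [YoungDiagram.card, Finset.card_eq_sum_card_fiberwise (f := fun c => T c.1 c.2)
    (t := Finset.range r) fun c hc => Finset.mem_coe.mpr (Finset.mem_range.mpr (h2 c hc))]
  exact Finset.sum_congr rfl fun i hi => h3 i (Finset.mem_range.mp hi)

theorem IsColTab.eq_of_row {lam : YoungDiagram} {T : ℕ → ℕ → ℕ} (H : IsColTab lam T)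
    {x y : ℕ × ℕ} (hx : x ∈ lam.cells) (hy : y ∈ lam.cells) (hrow : x.1 = y.1)
    (he : T x.1 x.2 = T y.1 y.2) : x = y := by
  refine Prod.ext hrow ?_
  rcases lt_trichotomy x.2 y.2 with h | h | h
  · have := H.row (i := y.1) h hy
    rw [hrow] at he
    omega
  · exact h
  · have := H.row (i := x.1) h hx
    rw [← hrow] at he
    omega

/-- The squares count ordered pairs of cells with equal entries. Equal entries in one row belong to
one cell, so these pairs are the diagonal together with two copies of the pairs in different rows.
-/
theorem two_mul_equalPairs {cont : ℕ → ℕ} {r : ℕ} {lam : YoungDiagram} {T : ℕ → ℕ → ℕ}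
    (hT : T ∈ colTabs cont r lam) :
    2 * equalPairs lam T + lam.card = ∑ i ∈ Finset.range r, cont i * cont i := by
  obtain ⟨h1, h2, h3⟩ := mem_colTabs.mp hT
  have hall : ∑ x ∈ lam.cells, ∑ y ∈ lam.cells, (if T y.1 y.2 = T x.1 x.2 then 1 else 0) =
      ∑ i ∈ Finset.range r, cont i * cont i := by
    rw [← Finset.sum_fiberwise_of_maps_to (g := fun c => T c.1 c.2) (t := Finset.range r)
      fun c hc => Finset.mem_range.mpr (h2 c hc)]
    refine Finset.sum_congr rfl fun i hi => ?_
    have hi' := h3 i (Finset.mem_range.mp hi)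
    rw [Finset.sum_congr rfl (g := fun _ => cont i), Finset.sum_const, hi', smul_eq_mul]
    intro x hx
    rw [(Finset.mem_filter.mp hx).2, ← Finset.card_filter, hi']
  have hsplit : ∀ x ∈ lam.cells, ∀ y ∈ lam.cells, (if T y.1 y.2 = T x.1 x.2 then 1 else 0) =
      ((if y.1 < x.1 ∧ T y.1 y.2 = T x.1 x.2 then 1 else 0) +
        (if x.1 < y.1 ∧ T x.1 x.2 = T y.1 y.2 then 1 else 0)) + (if x = y then 1 else 0) := by
    intro x hx y hy
    by_cases he : T x.1 x.2 = T y.1 y.2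
    · rcases lt_trichotomy x.1 y.1 with h | h | h
      · have : x ≠ y := fun e => by rw [e] at h; exact lt_irrefl _ h
        simp [he, h, h.le, this]
      · have : x = y := h1.eq_of_row hx hy h he
        simp [this]
      · have : x ≠ y := fun e => by rw [e] at h; exact lt_irrefl _ h
        simp [he, h, h.le, this]
    · have : x ≠ y := fun e => he (by rw [e])
      simp [he, Ne.symm he, this]
  rw [← hall, Finset.sum_congr rfl fun x hx => Finset.sum_congr rfl (hsplit x hx)]
  simp only [Finset.sum_add_distrib]
  rw [Finset.sum_comm (f := fun x y : ℕ × ℕ => if x.1 < y.1 ∧ T x.1 x.2 = T y.1 y.2 then 1 else 0)]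
  have hd : ∑ x ∈ lam.cells, ∑ y ∈ lam.cells, (if x = y then 1 else 0) = lam.card := by
    rw [Finset.sum_congr rfl (g := fun _ => 1), ← Finset.card_eq_sum_ones]
    intro x hx
    rw [Finset.sum_ite_eq, if_pos hx]
  rw [hd, two_mul]
  rfl

/-- A letter occurring `m` times contributes `m(m-1)/2` pairs and `m` cells, together `⟨m⟩`. This is
the origin of the sign `(-1)^⟨μ⟩`. -/
theorem equalPairs_add_card {lam mu : YoungDiagram} {T : ℕ → ℕ → ℕ}
    (hT : T ∈ colTabs mu.rowLen (mu.colLen 0) lam) :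
    equalPairs lam T + lam.card = angPart mu := by
  have h1 := two_mul_equalPairs hT
  have h2 := card_of_mem_colTabs hT
  have h3 : 2 * angPart mu = ∑ i ∈ Finset.range (mu.colLen 0), mu.rowLen i * mu.rowLen i +
      ∑ i ∈ Finset.range (mu.colLen 0), mu.rowLen i := by
    rw [angPart_eq, Finset.mul_sum, ← Finset.sum_add_distrib]
    refine Finset.sum_congr rfl fun i _ => ?_
    rw [two_mul_ang]
    ring
  omega

/-- The sum of `rowInv` for a column tableau and its transpose and of `equalPairs`. -/
def shapeExp (lam : YoungDiagram) : ℕ :=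
  ∑ x ∈ lam.cells, ∑ y ∈ lam.cells, if y.1 = x.1 ∧ y.2 < x.2 then 1
    else if y.1 < x.1 then (if y.2 < x.2 then 2 else 1) else 0

/-- Each pair of cells contributes an amount fixed by its position. One cell strictly above and left
of the other has the smaller entry and is counted by both inversion numbers. Cells in one row count
once, in the transpose. In the remaining positions (one column, or one cell above and right of the
other), exactly one of the three statistics counts the pair, according to the order of its entries.
-/
theorem rowInv_add_rowInv_transpose {lam : YoungDiagram} {T : ℕ → ℕ → ℕ} (H : IsColTab lam T) :
    rowInv lam T + rowInv lam.transpose (fun i j => T j i) + equalPairs lam T = shapeExp lam := by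
  -- Pairs whose left cell is the lower one are renamed, so that `y` is never below `x` in any of
  -- the sums.
  have hsplit : rowInv lam.transpose (fun i j => T j i) =
      ∑ x ∈ lam.cells, ∑ y ∈ lam.cells,
        ((if y.1 ≤ x.1 ∧ y.2 < x.2 ∧ T y.1 y.2 < T x.1 x.2 then 1 else 0) +
        (if y.1 < x.1 ∧ x.2 < y.2 ∧ T x.1 x.2 < T y.1 y.2 then 1 else 0)) := by
    rw [rowInv_transpose]
    simp only [Finset.sum_add_distrib]
    rw [Finset.sum_comm (f := fun x y : ℕ × ℕ =>
      if y.1 < x.1 ∧ x.2 < y.2 ∧ T x.1 x.2 < T y.1 y.2 then 1 else 0), ← Finset.sum_add_distrib]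
    refine Finset.sum_congr rfl fun x _ => ?_
    rw [← Finset.sum_add_distrib]
    refine Finset.sum_congr rfl fun y _ => ?_
    by_cases h : y.1 ≤ x.1
    · simp [h, not_lt.mpr h]
    · simp [h, not_le.mp h]
  rw [hsplit, rowInv, equalPairs, shapeExp]
  simp only [← Finset.sum_add_distrib]
  refine Finset.sum_congr rfl fun x hx => Finset.sum_congr rfl fun y hy => ?_
  obtain ⟨a, b⟩ := x
  obtain ⟨c, d⟩ := y
  simp only
  rw [YoungDiagram.mem_cells] at hx hy
  rcases lt_trichotomy c a with h1 | rfl | h1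
  · rcases lt_trichotomy d b with h2 | rfl | h2
    · have h3 : T c d < T a b :=
        (H.row h2 (lam.up_left_mem h1.le le_rfl hx)).trans_le (H.col h1 hx)
      simp [h1, h1.le, h1.ne, h2, h3, h3.ne, not_lt.mpr h2.le]
    · have h3 := H.col h1 hx
      rcases h3.lt_or_eq with h3 | h3
      · simp [h1, h3, h3.ne]
      · simp [h1, h3]
    · rcases lt_trichotomy (T c d) (T a b) with h3 | h3 | h3
      · simp [h1, h2, h3, h3.ne, not_lt.mpr h2.le, not_lt.mpr h3.le]
      · simp [h1, h2, h3, not_lt.mpr h2.le]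
      · simp [h1, h2, h3, h3.ne', not_lt.mpr h2.le, not_lt.mpr h3.le]
  · by_cases h2 : d < b
    · have h3 := H.row h2 hx
      simp [h2, h3]
    · simp [h2]
  · simp [not_lt.mpr h1.le, not_le.mpr h1, h1.ne']

/-! ### The odd RSK correspondence -/

section Main

variable {k : Type*} [CommRing k]

/-- Replaces the sign of a chain of strips by the sorting sign of the transposed tableau; the
correction depends only on `μ` and `λ` and leaves the sum. -/
theorem foldl_rowLens_apply {lam mu : YoungDiagram} :
    (mu.rowLens.foldl (fun v b => addStrip k IsVStrip b v) (Finsupp.single ⊥ 1)) lam =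
      (-1) ^ (angPart mu + lam.card + shapeExp lam) *
        ((∑ T ∈ tableaux lam.transpose mu, tabSign T : ℤ) : k) := by
  rw [YoungDiagram.rowLens, foldl_addStrip_apply, Int.cast_sum, Finset.mul_sum]
  have hsign : ∀ T : SemistandardYoungTableau lam.transpose,
      (tabSign T : k) = (-1) ^ rowInv lam.transpose (fun i j => T i j) := fun T => by
    rw [tabSign, sortLength_rowWord]
    push_cast
    rfl
  simp only [hsign]
  rw [sum_tableaux_transpose lam mu fun T' =>
    (-1 : k) ^ (angPart mu + lam.card + shapeExp lam) *
      (-1) ^ rowInv lam.transpose (fun i j => T' j i)]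
  refine Finset.sum_congr rfl fun T hT => ?_
  rw [← pow_add]
  refine neg_one_pow_congr ?_
  rw [← rowInv_add_rowInv_transpose (mem_colTabs.mp hT).1, ← equalPairs_add_card hT]
  push_cast
  have two : (2 : ZMod 2) = 0 := rfl
  linear_combination -((equalPairs lam T : ZMod 2) + lam.card +
    rowInv lam.transpose (fun i j => T j i)) * two

theorem foldl_rowLens_eq_zero {lam mu : YoungDiagram} (H : lam.card ≠ mu.card) :
    (mu.rowLens.foldl (fun v b => addStrip k IsVStrip b v) (Finsupp.single ⊥ 1)) lam = 0 := by
  rw [YoungDiagram.rowLens, foldl_addStrip_apply]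
  refine Finset.sum_eq_zero fun T hT => absurd ?_ H
  rw [card_of_mem_colTabs hT, card_eq_sum_rowLen mu (rowLen_colLen mu)]

theorem fockForm_eq_sum {n : ℕ} {v : Fock k} (hv : ∀ lam, lam.card ≠ n → v lam = 0) (w : Fock k) :
    fockForm k v w = ∑ lam ∈ partitions n, (-1) ^ evenRows lam * v lam * w lam := by
  have hsub : v.support ⊆ partitions n := fun lam hlam => by
    rw [mem_partitions]
    by_contra hc
    exact Finsupp.mem_support_iff.mp hlam (hv lam hc)
  rw [fockForm, Finsupp.linearCombination_apply, Finsupp.sum_of_support_subset _ hsub _ (by simp),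
    LinearMap.sum_apply]
  refine Finset.sum_congr rfl fun lam _ => ?_
  simp only [LinearMap.smul_apply, Finsupp.lapply_apply, smul_eq_mul]
  ring

/-- The normalising sign of `T_λ` occurs in both factors and squares to one. -/
theorem kostka_mul_kostka (lam mu rho : YoungDiagram) : (kostka lam mu : k) * (kostka lam rho : k) =
    ((∑ T ∈ tableaux lam mu, tabSign T : ℤ) : k) * ((∑ T ∈ tableaux lam rho, tabSign T : ℤ) : k) := by
  rw [← Int.cast_mul, ← Int.cast_mul, kostka, kostka]
  congr 1
  have hs : tabSign (SemistandardYoungTableau.highestWeight lam) *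
      tabSign (SemistandardYoungTableau.highestWeight lam) = 1 := by
    rw [tabSign, ← pow_add, Even.neg_one_pow ⟨_, rfl⟩]
  linear_combination (∑ T ∈ tableaux lam mu, tabSign T) * (∑ T ∈ tableaux lam rho, tabSign T) * hs

theorem Mdd_eq_sum_evenRows {n : ℕ} {mu rho : YoungDiagram} (hmu : mu.card = n) :
    (-1 : k) ^ (angPart mu + angPart rho) * Mdd k mu rho =
      ∑ lam ∈ partitions n, (-1 : k) ^ evenRows lam * (kostka lam.transpose mu : k) *
        (kostka lam.transpose rho : k) := by
  rw [Mdd_eq, fockForm_eq_sum (n := n) (fun lam H => foldl_rowLens_eq_zero (hmu ▸ H)),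
    Finset.mul_sum]
  refine Finset.sum_congr rfl fun lam _ => ?_
  rw [foldl_rowLens_apply, foldl_rowLens_apply, mul_assoc ((-1 : k) ^ evenRows lam) (kostka _ _ : k),
    kostka_mul_kostka]
  simp only [pow_add]
  have hs : ∀ m : ℕ, ((-1 : k) ^ m) * (-1) ^ m = 1 := fun m => by
    rw [← pow_add, Even.neg_one_pow ⟨_, rfl⟩]
  generalize ((∑ T ∈ tableaux lam.transpose mu, tabSign T : ℤ) : k) = A
  generalize ((∑ T ∈ tableaux lam.transpose rho, tabSign T : ℤ) : k) = B
  have h1 := hs (angPart mu)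
  have h2 := hs (angPart rho)
  have h3 := hs lam.card
  have h4 := hs (shapeExp lam)
  calc _ = ((-1 : k) ^ angPart mu * (-1) ^ angPart mu) * ((-1) ^ angPart rho * (-1) ^ angPart rho) *
      ((-1) ^ lam.card * (-1) ^ lam.card) * ((-1) ^ shapeExp lam * (-1) ^ shapeExp lam) *
      ((-1) ^ evenRows lam * (A * B)) := by ring
    _ = _ := by rw [h1, h2, h3, h4]; ring

theorem sum_succ_eq_ang (m : ℕ) : ∑ j ∈ Finset.range m, (j + 1) = ang m := by
  induction m with
  | zero => rfl
  | succ m ih => rw [Finset.sum_range_succ, ih, ang_succ]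

/-- Since `⟨m⟩ = 1 + ⋯ + m`, the number `⟨λᵀ⟩` sums over the cells of `λ` their one-based row
numbers. Adding `|λ|` shifts these modulo two to the zero-based weights of `evenRows_cast`. -/
theorem angPart_transpose (lam : YoungDiagram) :
    ((angPart lam.transpose + lam.card : ℕ) : ZMod 2) = evenRows lam := by
  have h1 : angPart lam.transpose = ∑ c ∈ lam.transpose.cells, (c.2 + 1) := by
    rw [angPart_eq, sum_cells _ (rowLen_colLen _)]
    exact Finset.sum_congr rfl fun i _ => (sum_succ_eq_ang _).symm
  rw [h1, sum_cells_transpose, sum_cells lam (rowLen_colLen lam), evenRows_cast (rowLen_colLen lam),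
    card_eq_sum_rowLen lam (rowLen_colLen lam), ← Finset.sum_add_distrib, Nat.cast_sum]
  refine Finset.sum_congr rfl fun i _ => ?_
  simp only [Prod.snd_swap, Finset.sum_const, Finset.card_range, smul_eq_mul]
  have two : (2 : ZMod 2) = 0 := rfl
  push_cast
  linear_combination (lam.rowLen i : ZMod 2) * two

end Main

end

end OddSym

theorem mainTheorem11 {k : Type*} [CommRing k] (n : ℕ) (mu rho : YoungDiagram)
    (hmu : mu.card = n) (hrho : rho.card = n) :
    (-1 : k) ^ (OddSym.angPart mu + OddSym.angPart rho) * OddSym.Mdd k mu rho =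
        ∑ lam ∈ OddSym.partitions n,
          (-1 : k) ^ (OddSym.angPart lam.transpose + lam.card) *
            (OddSym.kostka lam.transpose mu : k) * (OddSym.kostka lam.transpose rho : k) ∧
    (-1 : k) ^ (OddSym.angPart mu + OddSym.angPart rho) * OddSym.Mdd k mu rho =
        ∑ lam ∈ OddSym.partitions n,
          (-1 : k) ^ OddSym.evenRows lam *
            (OddSym.kostka lam.transpose mu : k) * (OddSym.kostka lam.transpose rho : k) := by
  refine ⟨?_, OddSym.Mdd_eq_sum_evenRows hmu⟩
  rw [OddSym.Mdd_eq_sum_evenRows hmu]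
  refine Finset.sum_congr rfl fun lam _ => ?_
  rw [OddSym.neg_one_pow_congr (OddSym.angPart_transpose lam)]
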